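/- **Setting.** Let $D\subset\mathbb R^d$ be compact with $\mu(D)>0$, where $\mu$ is Lebesgue measure. Let $0<L\le\infty$ and let $F:(-L,L)\to\mathbb R$ be $C^2$, odd, with $F'>0$; write $G=F^{-1}$. Let $\nu,\theta^0:D\to\mathbb R$ and $\phi:D\times D\to\mathbb R$, with $\phi(x,y)=\phi(y,x)$, and let $\kappa\in\mathbb R$. For a real function $f$ write $\mathcal D(f)=\sup f-\inf f$. Assume: * $(\mathcal F_B1)$ There are Lebesgue measurable sets $D^N_\alpha$ ($N\ge0$, $1\le\alpha\le2^N$) with $D^0_1=D$, $D^N_\alpha=D^{N+1}_{2\alpha-1}\uplus D^{N+1}_{2\alpha}$ (disjoint union), $\mu(D^{N+1}_{2\alpha-1})=\mu(D^{N+1}_{2\alpha})$, and $\lim_{N\to\infty}\max_\alpha\operatorname{diam}(D^N_\alpha)=0$. Fix such sets. * $(\mathcal F_B2)$ $\nu,\phi,\theta^0$ are continuous. * $(\mathcal F_B3)$ There are $b_\Phi\ge a_\Phi>0$, $-L<a_G<b_G<L$ and $\theta_*\in(0,\pi/2)$ such that $\mathcal D(\theta^0)\le\theta_*$, $a_\Phi\le\phi\le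 b_\Phi$ on $D\times D$, $$\kappa>\max\Big\{\frac{\mathcal D(\nu)}{a_\Phi\sin\theta_*},\ \frac{2M}{a_\Phi\,m^2\cos\theta_*}\Big\},\qquad F(a_G)+\kappa b_\Phi\le\nu(x)\le F(b_G)-\kappa b_\Phi\quad\text{for all }x\in D,$$ where $m=\min_{[F(a_G),F(b_G)]}G'$ and $M$ is the maximum over $(x,y)\in[a_G,b_G]^2$ of $\frac{x-y}{F(x)-F(y)}$ (read as $1/F'(x)$ if $x=y$). For $N\ge1$ let $(\theta^N_\alpha)_{1\le\alpha\le2^N}$ be a global solution of the lattice generalized Kuramoto (GK) model $$F(\dot\theta^N_\alpha)=\nu^N_\alpha+\frac{\kappa}{2^N}\sum_{\beta=1}^{2^N}\phi^N_{\alpha\beta}\sin(\theta^N_\beta-\theta^N_\alpha)\quad(t>0),\qquad\theta^N_\alpha(0)=\theta^{N,0}_\alpha,$$ where $\nu^N_\alpha$ and $\theta^{N,0}_\alpha$ are the averages of $\nu$ and $\theta^0$ over $D^N_\alpha$ and $\phi^N_{\alpha\beta}$ is the average of $\phi$ over $D^N_\alpha\times D^N_\beta$. Put $\theta^N(t,x)=\sum_\alpha\theta^N_\alpha(t)\mathbf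 1_{D^N_\alpha}(x)$. A (global) *classical solution* of the continuum GK model is a $\theta\in C^1([0,\infty);L^\infty(D))$ with $\theta(0,x)=\theta^0(x)$ for a.e. $x\in D$ and, for all $t\ge0$ and a.e. $x\in D$, $$F(\partial_t\theta(t,x))=\nu(x)+\frac{\kappa}{\mu(D)}\int_D\phi(x,z)\sin(\theta(t,z)-\theta(t,x))\,d\mu(z).$$ **Theorem 4.1.** There is a unique limit $\theta\in C^1([0,\infty);L^\infty(D))$ such that 1. $\displaystyle\lim_{N\to\infty}\ \sup_{t\ge0}\ \operatorname*{ess\,sup}_{x\in D}|\theta^N(t,x)-\theta(t,x)|=0$; 2. $\theta$ has a continuous version, belonging to $C^1([0,\infty);C(D))$, and this is the unique classical solution of the continuum GK model (uniqueness being up to equality a.e. in $x$, for each $t\ge0$). -/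

import Mathlib

open MeasureTheory Set Filter Topology

noncomputable section

/-- The open interval `(-L, L)` of real numbers, where `L` may be `+∞`. -/
def phaseInterval (L : EReal) : Set ℝ :=
  {ω : ℝ | -L < (ω : EReal) ∧ (ω : EReal) < L}

/-- The structural conditions on `F : (-L, L) → ℝ`: it is `C²`, odd, and has positive derivative.
Only the values of `F` on `(-L, L)` matter. -/
structure IsGKNonlinearity (L : EReal) (F : ℝ → ℝ) : Prop where
  pos : 0 < L
  contDiffOn : ContDiffOn ℝ 2 F (phaseInterval L)
  odd : ∀ ω ∈ phaseInterval L, F (-ω) = -F ω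
  deriv_pos : ∀ ω ∈ phaseInterval L, 0 < deriv F ω

/-- The inverse function `G = F⁻¹`, defined on the range of `F` on `(-L, L)`. -/
def phaseInverse (L : EReal) (F : ℝ → ℝ) : ℝ → ℝ :=
  Function.invFunOn F (phaseInterval L)

open Classical in
/-- The reciprocal difference quotient of `F`, extended by `1 / F'` to the diagonal. -/
def recipQuotient (F : ℝ → ℝ) (x y : ℝ) : ℝ :=
  if x = y then 1 / deriv F x else (x - y) / (F x - F y)

/-- The maximum over `[a, b]²` of the reciprocal difference quotient of `F`. -/
def maxRecipQuotient (F : ℝ → ℝ) (a b : ℝ) : ℝ :=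
  sSup ((fun p : ℝ × ℝ => recipQuotient F p.1 p.2) '' (Icc a b ×ˢ Icc a b))

/-- The minimum of `G' = (F⁻¹)'` over `[F a, F b]`. -/
def minDerivInverse (L : EReal) (F : ℝ → ℝ) (a b : ℝ) : ℝ :=
  sInf (deriv (phaseInverse L F) '' Icc (F a) (F b))

/-- The diameter `sup f - inf f` of the range of `f`. -/
def rangeDiam {X : Type*} (f : X → ℝ) : ℝ :=
  (⨆ x, f x) - ⨅ x, f x

section Continuum

/-- Lebesgue measure on the subset `D` of `ℝᵈ`, as a measure on the type of points of `D`. -/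
abbrev lebesgueOn {d : ℕ} (D : Set (EuclideanSpace ℝ (Fin d))) : Measure D :=
  (volume : Measure (EuclideanSpace ℝ (Fin d))).comap Subtype.val

variable {d : ℕ} {D : Set (EuclideanSpace ℝ (Fin d))}

/-- A sequence of dyadic partitions of `D` into Lebesgue measurable cells: the `N`-th partition has
the cells `cell N α`, `α < 2 ^ N` (counted from `0`, so that the cell with number `α` splits into
those with numbers `2 α` and `2 α + 1`), the two halves of a cell have equal measure, and the
largest diameter of a cell tends to zero. -/
structure IsDyadicPartition (cell : ℕ → ℕ → Set D) : Prop where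
  nullMeasurableSet : ∀ N, ∀ α < 2 ^ N, NullMeasurableSet (cell N α) (lebesgueOn D)
  root : cell 0 0 = univ
  split : ∀ N, ∀ α < 2 ^ N, cell N α = cell (N + 1) (2 * α) ∪ cell (N + 1) (2 * α + 1)
  disjoint : ∀ N, ∀ α < 2 ^ N, Disjoint (cell (N + 1) (2 * α)) (cell (N + 1) (2 * α + 1))
  volume_eq : ∀ N, ∀ α < 2 ^ N,
    (lebesgueOn D) (cell (N + 1) (2 * α)) = (lebesgueOn D) (cell (N + 1) (2 * α + 1))
  tendsto_diam : Tendsto (fun N : ℕ => ⨆ α : Fin (2 ^ N), Metric.diam (cell N α)) atTop (𝓝 0)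

/-- The large-coupling framework on the parameters and the data. -/
def LargeCoupling (L : EReal) (F : ℝ → ℝ) (κ : ℝ)
    (ν : C(D, ℝ)) (φ : C(D × D, ℝ)) (θ₀ : C(D, ℝ)) : Prop :=
  ∃ aΦ bΦ aG bG θs : ℝ,
    0 < aΦ ∧ aΦ ≤ bΦ ∧
    aG ∈ phaseInterval L ∧ bG ∈ phaseInterval L ∧ aG < bG ∧
    0 < θs ∧ θs < Real.pi / 2 ∧
    rangeDiam θ₀ ≤ θs ∧
    (∀ x y : D, aΦ ≤ φ (x, y) ∧ φ (x, y) ≤ bΦ) ∧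
    κ > max (rangeDiam ν / (aΦ * Real.sin θs))
      (2 * maxRecipQuotient F aG bG / (aΦ * minDerivInverse L F aG bG ^ 2 * Real.cos θs)) ∧
    ∀ x : D, F aG + κ * bΦ ≤ ν x ∧ ν x ≤ F bG - κ * bΦ

/-- The average of `f` over the cell `α` of the `N`-th partition, whose measure is
`μ(D) / 2 ^ N`. -/
def cellAverage (cell : ℕ → ℕ → Set D) (f : D → ℝ) (N α : ℕ) : ℝ :=
  2 ^ N / volume.real D * ∫ x in cell N α, f x ∂(lebesgueOn D)

/-- The average of `φ` over the product of the cells `α` and `β` of the `N`-th partition. -/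
def cellAverage₂ (cell : ℕ → ℕ → Set D) (φ : D × D → ℝ) (N α β : ℕ) : ℝ :=
  2 ^ (2 * N) / volume.real D ^ 2 *
    ∫ x in cell N α, ∫ y in cell N β, φ (x, y) ∂(lebesgueOn D) ∂(lebesgueOn D)

/-- `Θ α t`, `α < 2 ^ N`, is a global solution of the lattice GK model with `2 ^ N` oscillators
whose natural frequencies, weights and initial phases are the cell averages of `ν`, `φ`, `θ₀`. -/
structure IsLatticeSolution (L : EReal) (F : ℝ → ℝ) (κ : ℝ)
    (ν : C(D, ℝ)) (φ : C(D × D, ℝ)) (θ₀ : C(D, ℝ))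
    (cell : ℕ → ℕ → Set D) (N : ℕ) (Θ : ℕ → ℝ → ℝ) : Prop where
  continuousOn : ∀ α < 2 ^ N, ContinuousOn (Θ α) (Ici 0)
  initial : ∀ α < 2 ^ N, Θ α 0 = cellAverage cell θ₀ N α
  equation : ∀ α < 2 ^ N, ∀ t : ℝ, 0 < t → ∃ ω ∈ phaseInterval L, HasDerivAt (Θ α) ω t ∧
    F ω = cellAverage cell ν N α +
      κ / 2 ^ N * ∑ β ∈ Finset.range (2 ^ N),
        cellAverage₂ cell φ N α β * Real.sin (Θ β t - Θ α t)

/-- The function that equals `Θ α t` on the cell `α` of the `N`-th partition. -/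
def stepFunction (cell : ℕ → ℕ → Set D) (N : ℕ) (Θ : ℕ → ℝ → ℝ) (t : ℝ) (x : D) : ℝ :=
  ∑ α ∈ Finset.range (2 ^ N), (cell N α).indicator (fun _ => Θ α t) x

/-- `u` is a global classical solution of the continuum GK model: it is represented by an element
`U` of `C¹([0, ∞); L^∞(D))`, it satisfies the integro-differential equation for all `t ≥ 0` and
almost every `x`, and it takes the initial datum almost everywhere. -/
def IsClassicalSolution (L : EReal) (F : ℝ → ℝ) (κ : ℝ)
    (ν : C(D, ℝ)) (φ : C(D × D, ℝ)) (θ₀ : C(D, ℝ)) (u : ℝ → D → ℝ) : Prop :=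
  ∃ U : ℝ → Lp ℝ ⊤ (lebesgueOn D),
    ContDiffOn ℝ 1 U (Ici 0) ∧
    (∀ t : ℝ, 0 ≤ t → ∀ᵐ x ∂(lebesgueOn D), u t x = U t x) ∧
    (∀ t : ℝ, 0 ≤ t → ∀ᵐ x ∂(lebesgueOn D), derivWithin U (Ici 0) t x ∈ phaseInterval L ∧
      F (derivWithin U (Ici 0) t x) = ν x +
        κ / volume.real D *
          ∫ z : D, φ (x, z) * Real.sin (u t z - u t x) ∂(lebesgueOn D)) ∧
    ∀ᵐ x ∂(lebesgueOn D), u 0 x = θ₀ x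

/-- `θN N` converges to `θ` as `N → ∞` in the essential supremum norm, uniformly in `t ≥ 0`. -/
def ConvergesUniformlyEssSup (θN : ℕ → ℝ → D → ℝ)
    (θ : ℝ → Lp ℝ ⊤ (lebesgueOn D)) : Prop :=
  Tendsto (fun N : ℕ => ⨆ t ∈ Ici (0 : ℝ),
    essSup (fun x : D => ENNReal.ofReal |θN N t x - θ t x|) (lebesgueOn D)) atTop (𝓝 0)

end Continuum

end

noncomputable section

/-! The bounds on `ν` confine the right-hand side of both models to `[F aG, F bG]` whatever the
phases are, so `F` can be inverted once and for all by a bounded, globally Lipschitz `g`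
(`IsGKNonlinearity.exists_isTruncatedInverse`). Both models become ODEs with bounded Lipschitz
fields, the continuum one on `C(D)` and on `L^∞(D)` simultaneously. The flow on `C(D)`, embedded in
`L^∞(D)`, is the limit `θ`; its continuous version thus comes for free, and uniqueness of classical
solutions is uniqueness for a Lipschitz ODE.

At step functions the lattice field differs from the continuum field only by the oscillation of `ν`
and `φ` on cells (`dist_stepLp_gkFieldLp_le`), so Grönwall gives convergence on each `[0, T]`
(`eventually_dist_stepLp_le`).

The Grönwall bound degrades as `T` grows; uniformity in time comes from synchronization. Strong
coupling traps phase differences below some `δ < π / 2` (`lattice_phase_sub_lt`). There the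
transformed frequencies `F (dθ i / dt)` obey a consensus system with positive weights, and their
diameter decays exponentially at a rate independent of `N` (`lattice_force_sub_lt`). Their mean is
conserved and equals the mean of `ν`, the same for all `N`. Hence after time `T` every lattice
rotates by the same `ω * (t - T)` up to an error that vanishes as `T → ∞` (`lattice_drift_le`), and
closeness at time `T` persists at all later times (`eventually_forall_dist_le_of_drift`). -/

/-! ### Global flows of bounded Lipschitz fields, and a barrier principle. -/

theorem exists_hasDerivAt_of_lipschitzWith {E : Type*} [NormedAddCommGroup E] [NormedSpace ℝ E]
    [CompleteSpace E] {v : E → E} {K C : NNReal} (hv : LipschitzWith K v)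
    (hC : ∀ x, ‖v x‖ ≤ C) (x₀ : E) :
    ∃ u : ℝ → E, u 0 = x₀ ∧ ∀ t, HasDerivAt u (v (u t)) t := by
  have key : ∀ n : ℕ, ∃ α : ℝ → E, α 0 = x₀ ∧
      ∀ t ∈ Ioo (-(n + 1 : ℝ)) (n + 1), HasDerivAt α (v (α t)) t := by
    intro n
    have h0 : (0 : ℝ) ∈ Icc (-(n + 1 : ℝ)) (n + 1) := ⟨by linarith [n.cast_nonneg (α := ℝ)],
      by positivity⟩
    -- At speed at most `C`, a solution travels at most `C * (n + 1)` in this time, so a ball of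
    -- that radius suffices.
    have hpl : IsPicardLindelof (fun _ : ℝ => v) (⟨0, h0⟩ : Icc (-(n + 1 : ℝ)) (n + 1)) x₀
        (C * (n + 1)) 0 C K :=
      { lipschitzOnWith := fun t _ => hv.lipschitzOnWith
        continuousOn := fun x _ => continuousOn_const
        norm_le := fun t _ x _ => hC x
        mul_max_le := by simp }
    obtain ⟨α, h1, h2⟩ := hpl.exists_eq_forall_mem_Icc_hasDerivWithinAt₀
    exact ⟨α, h1, fun t ht => (h2 t (Ioo_subset_Icc_self ht)).hasDerivAt
      (Icc_mem_nhds ht.1 ht.2)⟩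
  choose α h0 hα using key
  have huniq : ∀ n m : ℕ, n ≤ m → EqOn (α n) (α m) (Ioo (-(n + 1 : ℝ)) (n + 1)) := by
    intro n m hnm
    have hnm' : (n : ℝ) ≤ m := by exact_mod_cast hnm
    have hn := n.cast_nonneg (α := ℝ)
    refine ODE_solution_unique_of_mem_Ioo (v := fun _ => v) (s := fun _ => univ) (K := K)
      (t₀ := 0) (fun t _ => hv.lipschitzOnWith) ⟨by linarith, by linarith⟩
      (fun t ht => ⟨hα n t ht, trivial⟩)
      (fun t ht => ⟨hα m t ⟨by linarith [ht.1], by linarith [ht.2]⟩, trivial⟩) ?_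
    rw [h0, h0]
  have hmem : ∀ t : ℝ, ∀ n : ℕ, |t| < n + 1 → α ⌈|t|⌉₊ t = α n t := by
    intro t n ht
    have ht' : |t| < (⌈|t|⌉₊ : ℝ) + 1 := by linarith [Nat.le_ceil |t|]
    rcases le_total ⌈|t|⌉₊ n with h | h
    · exact huniq _ _ h (abs_lt.1 ht')
    · exact (huniq _ _ h (abs_lt.1 ht)).symm
  refine ⟨fun t => α ⌈|t|⌉₊ t, by simp [h0], fun t => ?_⟩
  set n := ⌈|t|⌉₊ with hn
  have ht : |t| < (n : ℝ) + 1 := by linarith [Nat.le_ceil |t|]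
  refine (hα n t (abs_lt.1 ht)).congr_of_eventuallyEq ?_
  filter_upwards [(isOpen_lt continuous_abs continuous_const).mem_nhds ht] with s hs
  exact hmem s n hs

/-- A finite family of functions starting below a barrier stays below it, provided that whenever
one of them touches the barrier from below its derivative is less than that of the barrier. -/
theorem forall_lt_of_deriv_lt_on_contact {ι : Type*} [Finite ι] {f f' : ι → ℝ → ℝ}
    {B B' : ℝ → ℝ} (hf : ∀ i, ContinuousOn (f i) (Ici 0))
    (hf' : ∀ i, ∀ t > 0, HasDerivAt (f i) (f' i t) t)
    (hB : ContinuousOn B (Ici 0)) (hB' : ∀ t > 0, HasDerivAt B (B' t) t)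
    (h0 : ∀ i, f i 0 < B 0)
    (hcontact : ∀ t > 0, (∀ j, f j t ≤ B t) → ∀ i, f i t = B t → f' i t < B' t) :
    ∀ t ≥ 0, ∀ i, f i t < B t := by
  by_contra! hcon
  obtain ⟨t₁, ht₁, i₁, hi₁⟩ := hcon
  -- The times at which some function has reached the barrier. Finiteness of `ι` makes this set
  -- closed, so its infimum is a first contact time.
  set S : Set ℝ := ⋃ i, {t ∈ Ici (0 : ℝ) | B t ≤ f i t} with hS
  have hclosed : IsClosed S :=
    isClosed_iUnion_of_finite fun i => isClosed_Ici.isClosed_le hB (hf i)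
  have hne : S.Nonempty := ⟨t₁, mem_iUnion.2 ⟨i₁, ht₁, hi₁⟩⟩
  have hbdd : BddBelow S := ⟨0, fun t ht => by
    obtain ⟨i, hi⟩ := mem_iUnion.1 ht; exact hi.1⟩
  obtain ⟨i, hi0, hi⟩ := mem_iUnion.1 (hclosed.csInf_mem hne hbdd)
  set t := sInf S with ht
  have hlt : ∀ s, 0 ≤ s → s < t → ∀ j, f j s < B s := by
    intro s hs hst j
    by_contra! h
    exact absurd (csInf_le hbdd (mem_iUnion.2 ⟨j, hs, h⟩)) (not_le.2 hst)
  have htpos : 0 < t := by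
    rcases (mem_Ici.1 hi0).eq_or_lt with h | h
    · rw [← h] at hi; exact absurd hi (not_le.2 (h0 i))
    · exact h
  have hev : ∀ᶠ s in 𝓝[<] t, ∀ j, f j s < B s := by
    filter_upwards [Ioo_mem_nhdsLT htpos] with s hs using hlt s hs.1.le hs.2
  have hle : ∀ j, f j t ≤ B t := fun j =>
    le_of_tendsto_of_tendsto ((hf' j t htpos).continuousAt.tendsto.mono_left nhdsWithin_le_nhds)
      ((hB' t htpos).continuousAt.tendsto.mono_left nhdsWithin_le_nhds)
      (hev.mono fun s hs => (hs j).le)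
  have heq : f i t = B t := le_antisymm (hle i) hi
  have hd := hcontact t htpos hle i heq
  have hder : HasDerivWithinAt (fun s => f i s - B s) (f' i t - B' t) (Iio t) t :=
    ((hf' i t htpos).sub (hB' t htpos)).hasDerivWithinAt
  have hslope := hasDerivWithinAt_iff_tendsto_slope.1 hder
  -- Before the contact `f i - B` is negative and at the contact it is zero, so its left slopes are
  -- nonnegative, contrary to `hcontact`.
  have : 0 ≤ f' i t - B' t := by
    rw [sdiff_singleton_eq_self (by simp)] at hslope
    refine ge_of_tendsto hslope ?_
    filter_upwards [hev, self_mem_nhdsWithin] with s hs hst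
    rw [slope_def_field]
    exact div_nonneg_of_nonpos (by linarith [hs i]) (by linarith [mem_Iio.1 hst])
  linarith

/-! ### The nonlinearity and its truncated inverse. -/

theorem isOpen_phaseInterval (L : EReal) : IsOpen (phaseInterval L) :=
  (isOpen_lt continuous_const continuous_coe_real_ereal).inter
    (isOpen_lt continuous_coe_real_ereal continuous_const)

theorem ordConnected_phaseInterval (L : EReal) : (phaseInterval L).OrdConnected :=
  ⟨fun _ hx _ hy _ hz => ⟨hx.1.trans_le (EReal.coe_le_coe_iff.2 hz.1),
    (EReal.coe_le_coe_iff.2 hz.2).trans_lt hy.2⟩⟩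

theorem IsGKNonlinearity.differentiableOn {L : EReal} {F : ℝ → ℝ} (hF : IsGKNonlinearity L F) :
    DifferentiableOn ℝ F (phaseInterval L) :=
  hF.contDiffOn.differentiableOn (by norm_num)

theorem IsGKNonlinearity.strictMonoOn {L : EReal} {F : ℝ → ℝ} (hF : IsGKNonlinearity L F) :
    StrictMonoOn F (phaseInterval L) := by
  refine strictMonoOn_of_deriv_pos (ordConnected_phaseInterval L).convex
    hF.contDiffOn.continuousOn fun x hx => hF.deriv_pos x ?_
  rwa [(isOpen_phaseInterval L).interior_eq] at hx

/-- `g` is a bi-Lipschitz inverse of `F` on `[F a, F b]`, extended to the real line by a Lipschitz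
function with values in `[a, b]`. -/
structure IsTruncatedInverse (F g : ℝ → ℝ) (a b m K : ℝ) : Prop where
  mem : ∀ s, g s ∈ Icc a b
  apply_eq : ∀ s ∈ Icc (F a) (F b), F (g s) = s
  abs_sub_le : ∀ s t, |g s - g t| ≤ K * |s - t|
  mul_sub_le : ∀ s ∈ Icc (F a) (F b), ∀ t ∈ Icc (F a) (F b), s ≤ t → m * (t - s) ≤ g t - g s

/-- On the compact `[a, b]` the derivative of `F` lies between positive constants `c` and `C`, so
the slopes of the inverse lie in `[1 / C, 1 / c]`. Precomposing with the projection onto `[F a, F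
b]` extends it to the line without raising the Lipschitz constant. -/
theorem IsGKNonlinearity.exists_isTruncatedInverse {L : EReal} {F : ℝ → ℝ}
    (hF : IsGKNonlinearity L F) {a b : ℝ} (ha : a ∈ phaseInterval L) (hb : b ∈ phaseInterval L)
    (hab : a < b) : ∃ g m K, 0 < m ∧ 0 < K ∧ IsTruncatedInverse F g a b m K := by
  have hsub : Icc a b ⊆ phaseInterval L := (ordConnected_phaseInterval L).out ha hb
  have hne : (Icc a b).Nonempty := nonempty_Icc.2 hab.le
  have hcont : ContinuousOn (deriv F) (Icc a b) :=
    (hF.contDiffOn.continuousOn_deriv_of_isOpen (isOpen_phaseInterval L) (by norm_num)).mono hsub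
  obtain ⟨x₀, hx₀, hmin⟩ := isCompact_Icc.exists_isMinOn hne hcont
  obtain ⟨x₁, hx₁, hmax⟩ := isCompact_Icc.exists_isMaxOn hne hcont
  set c := deriv F x₀
  set C := deriv F x₁
  have hc : 0 < c := hF.deriv_pos _ (hsub hx₀)
  have hC : 0 < C := hF.deriv_pos _ (hsub hx₁)
  have hFc : ContinuousOn F (Icc a b) := hF.contDiffOn.continuousOn.mono hsub
  have hFd : DifferentiableOn ℝ F (interior (Icc a b)) :=
    hF.differentiableOn.mono (interior_subset.trans hsub)
  have hlow : ∀ x ∈ Icc a b, ∀ y ∈ Icc a b, x ≤ y → c * (y - x) ≤ F y - F x :=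
    (convex_Icc a b).mul_sub_le_image_sub_of_le_deriv hFc hFd
      fun x hx => hmin (interior_subset hx)
  have hupp : ∀ x ∈ Icc a b, ∀ y ∈ Icc a b, x ≤ y → F y - F x ≤ C * (y - x) :=
    (convex_Icc a b).image_sub_le_mul_sub_of_deriv_le hFc hFd
      fun x hx => hmax (interior_subset hx)
  have hFab : F a ≤ F b := (hF.strictMonoOn ha hb hab).le
  have hsurj : ∀ s : Icc (F a) (F b), ∃ w ∈ Icc a b, F w = s := fun s =>
    intermediate_value_Icc hab.le hFc s.2
  choose h hmem happ using hsurj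
  have hmono : ∀ s t : Icc (F a) (F b), (s : ℝ) ≤ t → h s ≤ h t := by
    intro s t hst
    by_contra! hlt
    have := hF.strictMonoOn (hsub (hmem t)) (hsub (hmem s)) hlt
    rw [happ, happ] at this
    linarith
  have hproj : ∀ s : ℝ, ∀ hs : s ∈ Icc (F a) (F b), projIcc (F a) (F b) hFab s = ⟨s, hs⟩ :=
    fun s hs => projIcc_of_mem hFab hs
  refine ⟨fun s => h (projIcc (F a) (F b) hFab s), 1 / C, 1 / c, by positivity, by positivity,
    fun s => hmem _, fun s hs => ?_, fun s t => ?_, fun s hs t ht hst => ?_⟩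
  · rw [hproj s hs, happ]
  · wlog hst : s ≤ t generalizing s t
    · rw [abs_sub_comm, abs_sub_comm s]
      exact this t s (le_of_not_ge hst)
    have h1 := monotone_projIcc hFab hst
    have h2 := hlow _ (hmem (projIcc _ _ hFab s)) _ (hmem (projIcc _ _ hFab t)) (hmono _ _ h1)
    rw [happ, happ] at h2
    have h3 : (projIcc (F a) (F b) hFab t : ℝ) - projIcc (F a) (F b) hFab s ≤ t - s := by
      simp only [coe_projIcc]
      grind
    rw [abs_of_nonpos (by linarith [hmono _ _ h1]), abs_of_nonpos (by linarith),
      one_div_mul_eq_div, le_div_iff₀ hc]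
    linarith
  · have h1 : (projIcc (F a) (F b) hFab s : ℝ) ≤ projIcc (F a) (F b) hFab t :=
      monotone_projIcc hFab hst
    have h2 := hupp _ (hmem (projIcc _ _ hFab s)) _ (hmem (projIcc _ _ hFab t)) (hmono _ _ h1)
    rw [happ, happ, hproj s hs, hproj t ht] at h2
    rw [hproj s hs, hproj t ht, one_div_mul_eq_div, div_le_iff₀ hC]
    linarith

/-- Turns the implicit equation into an ODE: `w` is not assumed to lie in `[a, b]`, but injectivity
of `F` on the whole phase interval forces it there. -/
theorem IsTruncatedInverse.eq_of_apply_eq {L : EReal} {F g : ℝ → ℝ} {a b m K : ℝ}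
    (hg : IsTruncatedInverse F g a b m K) (hF : IsGKNonlinearity L F) (ha : a ∈ phaseInterval L)
    (hb : b ∈ phaseInterval L) {w s : ℝ} (hw : w ∈ phaseInterval L) (hs : s ∈ Icc (F a) (F b))
    (h : F w = s) : w = g s :=
  hF.strictMonoOn.injOn hw ((ordConnected_phaseInterval L).out ha hb (hg.mem s))
    (h.trans (hg.apply_eq s hs).symm)

theorem Real.sin_add_le_sin_add_sin {p q : ℝ} (hp : 0 ≤ p) (hp' : p ≤ Real.pi) (hq : 0 ≤ q)
    (hq' : q ≤ Real.pi) : Real.sin (p + q) ≤ Real.sin p + Real.sin q := by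
  rw [Real.sin_add]
  have h1 := Real.sin_nonneg_of_nonneg_of_le_pi hp hp'
  have h2 := Real.sin_nonneg_of_nonneg_of_le_pi hq hq'
  nlinarith [Real.cos_le_one p, Real.cos_le_one q]

/-! ### Synchronization of the lattice model, with constants independent of its size. -/

section Lattice

variable {ι : Type*} [Fintype ι]

/-- The value of `F (dθ i / dt)` prescribed by the lattice GK model at the phases `θ`. -/
def latticeForce (κ : ℝ) (ν : ι → ℝ) (φ : ι → ι → ℝ) (θ : ι → ℝ) (i : ι) : ℝ :=
  ν i + κ / Fintype.card ι * ∑ j, φ i j * Real.sin (θ j - θ i)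

theorem latticeForce_mem_Icc [Nonempty ι] {κ A B b : ℝ} {ν : ι → ℝ} {φ : ι → ι → ℝ} (hκ : 0 ≤ κ)
    (hφ : ∀ i j, |φ i j| ≤ b) (hA : ∀ i, A + κ * b ≤ ν i) (hB : ∀ i, ν i ≤ B - κ * b)
    (θ : ι → ℝ) (i : ι) : latticeForce κ ν φ θ i ∈ Icc A B := by
  have hn : (0 : ℝ) < Fintype.card ι := by exact_mod_cast Fintype.card_pos
  have h1 : |∑ j, φ i j * Real.sin (θ j - θ i)| ≤ Fintype.card ι * b := by
    refine (Finset.abs_sum_le_sum_abs _ _).trans ?_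
    rw [← nsmul_eq_mul, Fintype.card]
    refine Finset.sum_le_card_nsmul _ _ _ fun j _ => ?_
    rw [abs_mul]
    have := Real.abs_sin_le_one (θ j - θ i)
    nlinarith [hφ i j, abs_nonneg (φ i j)]
  have h2 : |κ / Fintype.card ι * ∑ j, φ i j * Real.sin (θ j - θ i)| ≤ κ * b := by
    rw [abs_mul, abs_of_nonneg (by positivity), div_mul_eq_mul_div, div_le_iff₀ hn]
    nlinarith
  have := abs_le.1 h2
  simp only [latticeForce, mem_Icc]
  constructor <;> linarith [hA i, hB i]

/-- Symmetry of `φ` and oddness of the sine cancel the interaction in pairs. This conservation law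
identifies the common asymptotic frequency. -/
theorem sum_latticeForce (κ : ℝ) (ν : ι → ℝ) {φ : ι → ι → ℝ} (hφ : ∀ i j, φ i j = φ j i)
    (θ : ι → ℝ) : ∑ i, latticeForce κ ν φ θ i = ∑ i, ν i := by
  have h : ∑ i, ∑ j, φ i j * Real.sin (θ j - θ i) = 0 := by
    have h1 : ∑ i, ∑ j, φ i j * Real.sin (θ j - θ i)
        = -∑ i, ∑ j, φ i j * Real.sin (θ j - θ i) := by
      conv_lhs => rw [Finset.sum_comm]
      simp_rw [← Finset.sum_neg_distrib]
      refine Finset.sum_congr rfl fun i _ => Finset.sum_congr rfl fun j _ => ?_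
      rw [hφ j i, ← neg_sub, Real.sin_neg, mul_neg]
    linarith
  simp only [latticeForce, Finset.sum_add_distrib, ← Finset.mul_sum, h, mul_zero, add_zero]

/-- The phase diameter of a lattice GK flow stays below `δ`. -/
theorem lattice_phase_sub_lt [Nonempty ι] {κ a δ A B m : ℝ} {ν : ι → ℝ} {φ : ι → ι → ℝ}
    {g : ℝ → ℝ} {θ : ι → ℝ → ℝ} (hκ : 0 < κ) (hδ : 0 < δ)
    (hδ' : δ < Real.pi / 2) (hm : 0 < m) (hφ : ∀ i j, a ≤ φ i j)
    (hmem : ∀ x i, latticeForce κ ν φ x i ∈ Icc A B)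
    (hg : ∀ s ∈ Icc A B, ∀ t ∈ Icc A B, s ≤ t → m * (t - s) ≤ g t - g s)
    (hc : ∀ i, ContinuousOn (θ i) (Ici 0))
    (hd : ∀ i, ∀ t > 0, HasDerivAt (θ i) (g (latticeForce κ ν φ (fun j => θ j t) i)) t)
    (h0 : ∀ i j, θ i 0 - θ j 0 < δ) (hν : ∀ i j, ν i - ν j < κ * a * Real.sin δ) :
    ∀ t ≥ 0, ∀ i j, θ i t - θ j t < δ := by
  have hn : (0 : ℝ) < Fintype.card ι := by exact_mod_cast Fintype.card_pos
  suffices h : ∀ t ≥ 0, ∀ p : ι × ι, θ p.1 t - θ p.2 t < δ from fun t ht i j => h t ht (i, j)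
  refine forall_lt_of_deriv_lt_on_contact (f := fun (p : ι × ι) t => θ p.1 t - θ p.2 t)
    (B := fun _ => δ) (B' := fun _ => 0) (fun p => (hc p.1).sub (hc p.2))
    (fun p t ht => (hd p.1 t ht).sub (hd p.2 t ht)) continuousOn_const
    (fun t _ => hasDerivAt_const t δ) (fun p => h0 p.1 p.2) ?_
  rintro t - hle ⟨p, q⟩ hpq
  dsimp only at hle hpq ⊢
  set y := latticeForce κ ν φ (fun j => θ j t) with hy
  -- At contact `p` leads and `q` trails, `δ` apart, with every `j` between them. By subadditivity
  -- of the sine, each `j` pulls the two together with strength at least `a * sin δ`.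
  have hterm : ∀ j, φ p j * Real.sin (θ j t - θ p t) - φ q j * Real.sin (θ j t - θ q t)
      ≤ -(a * Real.sin δ) := by
    intro j
    have h1 := hle (j, q)
    have h2 := hle (p, j)
    dsimp only at h1 h2
    have hs1 : 0 ≤ Real.sin (θ p t - θ j t) :=
      Real.sin_nonneg_of_nonneg_of_le_pi (by linarith) (by linarith)
    have hs2 : 0 ≤ Real.sin (θ j t - θ q t) :=
      Real.sin_nonneg_of_nonneg_of_le_pi (by linarith) (by linarith)
    have hadd := Real.sin_add_le_sin_add_sin (p := θ p t - θ j t) (q := θ j t - θ q t)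
      (by linarith) (by linarith) (by linarith) (by linarith)
    have hsd : 0 ≤ Real.sin δ := Real.sin_nonneg_of_nonneg_of_le_pi hδ.le (by linarith)
    rw [sub_add_sub_cancel, hpq] at hadd
    rw [← neg_sub (θ p t), Real.sin_neg]
    -- The case `i = j` of `hν` reads `0 < κ * a * sin δ`.
    have ha : 0 < a := by
      have := hν p p
      rw [sub_self] at this
      by_contra! hneg
      linarith [mul_nonpos_of_nonpos_of_nonneg hneg (mul_nonneg hκ.le hsd)]
    nlinarith [mul_le_mul_of_nonneg_right (hφ p j) hs1, mul_le_mul_of_nonneg_right (hφ q j) hs2,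
      mul_le_mul_of_nonneg_left hadd ha.le]
  have hsum : (∑ j, φ p j * Real.sin (θ j t - θ p t)) - ∑ j, φ q j * Real.sin (θ j t - θ q t)
      ≤ Fintype.card ι * -(a * Real.sin δ) := by
    rw [← Finset.sum_sub_distrib, ← nsmul_eq_mul, Fintype.card]
    exact Finset.sum_le_card_nsmul _ _ _ fun j _ => hterm j
  have hylt : y p < y q := by
    have h1 : y p - y q = ν p - ν q + κ / Fintype.card ι *
        ((∑ j, φ p j * Real.sin (θ j t - θ p t)) - ∑ j, φ q j * Real.sin (θ j t - θ q t)) := by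
      simp only [hy, latticeForce]; ring
    have h2 := mul_le_mul_of_nonneg_left hsum (div_pos hκ hn).le
    have h3 : κ / Fintype.card ι * (Fintype.card ι * -(a * Real.sin δ))
        = -(κ * a * Real.sin δ) := by field_simp
    linarith [hν p q]
  have := hg _ (hmem _ p) _ (hmem _ q) hylt.le
  have : 0 < m * (y q - y p) := mul_pos hm (by linarith)
  linarith

/-- The diameter of the transformed frequencies `F (dθ i / dt)` of a lattice GK flow with small phase
diameter decays exponentially. -/
theorem lattice_force_sub_lt [Nonempty ι] {κ a δ A B m : ℝ} {ν : ι → ℝ} {φ : ι → ι → ℝ}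
    {g : ℝ → ℝ} {θ : ι → ℝ → ℝ} (hκ : 0 < κ) (ha : 0 < a)
    (hδ' : δ < Real.pi / 2) (hm : 0 < m) (hφ : ∀ i j, a ≤ φ i j)
    (hmem : ∀ x i, latticeForce κ ν φ x i ∈ Icc A B)
    (hg : ∀ s ∈ Icc A B, ∀ t ∈ Icc A B, s ≤ t → m * (t - s) ≤ g t - g s)
    (hc : ∀ i, ContinuousOn (θ i) (Ici 0))
    (hd : ∀ i, ∀ t > 0, HasDerivAt (θ i) (g (latticeForce κ ν φ (fun j => θ j t) i)) t)
    (hphase : ∀ t ≥ 0, ∀ i j, θ i t - θ j t < δ) :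
    ∀ t ≥ 0, ∀ i j, latticeForce κ ν φ (fun j => θ j t) i - latticeForce κ ν φ (fun j => θ j t) j
      < (B - A + 1) * Real.exp (-(κ * a * Real.cos δ * m / 2 * t)) := by
  have hn : (0 : ℝ) < Fintype.card ι := by exact_mod_cast Fintype.card_pos
  set y : ι → ℝ → ℝ := fun i t => latticeForce κ ν φ (fun j => θ j t) i with hy
  -- Differentiating the force gives a consensus system for `y`, with weights `φ * cos` bounded
  -- below by `a * cos δ`.
  set y' : ι → ℝ → ℝ := fun i t => κ / Fintype.card ι *
    ∑ j, φ i j * (Real.cos (θ j t - θ i t) * (g (y j t) - g (y i t))) with hy'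
  have hyd : ∀ i, ∀ t > 0, HasDerivAt (y i) (y' i t) t := fun i t ht =>
    ((HasDerivAt.fun_sum fun j _ =>
      (((hd j t ht).sub (hd i t ht)).sin.const_mul (φ i j))).const_mul _).const_add _
  have hyc : ∀ i, ContinuousOn (y i) (Ici 0) := fun i =>
    continuousOn_const.add (continuousOn_const.mul (continuousOn_finsetSum _ fun j _ =>
      continuousOn_const.mul (Real.continuous_sin.comp_continuousOn ((hc j).sub (hc i)))))
  obtain ⟨i₀⟩ := ‹Nonempty ι›
  have hδ : 0 < δ := by have := hphase 0 le_rfl i₀ i₀; linarith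
  have hAB : A ≤ B := (hmem 0 i₀).1.trans (hmem 0 i₀).2
  have hcos : 0 < Real.cos δ := Real.cos_pos_of_mem_Ioo ⟨by linarith, hδ'⟩
  -- Half of the decay rate that holds at contact, so that the derivative comparison there is
  -- strict.
  set r := κ * a * Real.cos δ * m / 2 with hr
  suffices h : ∀ t ≥ 0, ∀ p : ι × ι, y p.1 t - y p.2 t < (B - A + 1) * Real.exp (-(r * t)) from
    fun t ht i j => h t ht (i, j)
  refine forall_lt_of_deriv_lt_on_contact (f := fun (p : ι × ι) t => y p.1 t - y p.2 t)
    (B := fun t => (B - A + 1) * Real.exp (-(r * t)))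
    (B' := fun t => (B - A + 1) * (Real.exp (-(r * t)) * -(r * 1)))
    (fun p => (hyc p.1).sub (hyc p.2))
    (fun p t ht => (hyd p.1 t ht).sub (hyd p.2 t ht)) (by fun_prop)
    (fun t _ => (((hasDerivAt_id t).const_mul r).neg.exp).const_mul _)
    -- Forces differ initially by at most `B - A`; the `+ 1` makes the inequality strict.
    (fun p => by
      have h1 := hmem (fun j => θ j 0) p.1
      have h2 := hmem (fun j => θ j 0) p.2
      simp only [hy, mul_zero, neg_zero, Real.exp_zero]
      linarith [h1.2, h2.1]) ?_
  rintro t ht hle ⟨p, q⟩ hpq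
  dsimp only at hle hpq ⊢
  set D := (B - A + 1) * Real.exp (-(r * t)) with hD
  have hDpos : 0 < D := mul_pos (by linarith) (Real.exp_pos _)
  have hcosle : ∀ i j, Real.cos δ ≤ Real.cos (θ j t - θ i t) := by
    intro i j
    rw [← Real.cos_abs (θ j t - θ i t)]
    refine Real.cos_le_cos_of_nonneg_of_le_pi (abs_nonneg _) (by linarith) ?_
    rw [abs_le]
    constructor <;> linarith [hphase t ht.le i j, hphase t ht.le j i]
  have hcoef : ∀ i j, a * Real.cos δ ≤ φ i j * Real.cos (θ j t - θ i t) := fun i j =>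
    mul_le_mul (hφ i j) (hcosle i j) hcos.le (ha.le.trans (hφ i j))
  have hgmono : ∀ i j, y i t ≤ y j t → g (y i t) ≤ g (y j t) := by
    intro i j hij
    have := hg _ (hmem _ i) _ (hmem _ j) hij
    have : 0 ≤ m * (y j t - y i t) := mul_nonneg hm.le (by linarith)
    linarith
  -- At contact `y p` is maximal and `y q` minimal, so each difference of `g` has a fixed sign and
  -- its weight may be replaced by the lower bound. In the difference of the two sums `g (y j t)`
  -- then cancels.
  have hp : ∀ j, φ p j * (Real.cos (θ j t - θ p t) * (g (y j t) - g (y p t)))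
      ≤ a * Real.cos δ * (g (y j t) - g (y p t)) := by
    intro j
    have h1 := hgmono j p (by have := hle (j, q); dsimp only at this; linarith)
    nlinarith [hcoef p j]
  have hq : ∀ j, a * Real.cos δ * (g (y j t) - g (y q t))
      ≤ φ q j * (Real.cos (θ j t - θ q t) * (g (y j t) - g (y q t))) := by
    intro j
    have h1 := hgmono q j (by have := hle (p, j); dsimp only at this; linarith)
    nlinarith [hcoef q j]
  have hsum : (∑ j, φ p j * (Real.cos (θ j t - θ p t) * (g (y j t) - g (y p t))))
      - ∑ j, φ q j * (Real.cos (θ j t - θ q t) * (g (y j t) - g (y q t)))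
      ≤ Fintype.card ι * (a * Real.cos δ * (g (y q t) - g (y p t))) := by
    rw [← Finset.sum_sub_distrib, ← nsmul_eq_mul, Fintype.card]
    exact Finset.sum_le_card_nsmul _ _ _ fun j _ => by linarith [hp j, hq j]
  have hlow : m * D ≤ g (y p t) - g (y q t) := by
    rw [← hpq]
    exact hg _ (hmem _ q) _ (hmem _ p) (by
      have : 0 < y p t - y q t := by rw [hpq]; exact hDpos
      simp only [hy] at this
      linarith)
  have h1 : y' p t - y' q t ≤ κ * (a * Real.cos δ * (g (y q t) - g (y p t))) := by
    have h2 := mul_le_mul_of_nonneg_left hsum (div_pos hκ hn).le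
    have h3 : κ / Fintype.card ι * (Fintype.card ι * (a * Real.cos δ * (g (y q t) - g (y p t))))
        = κ * (a * Real.cos δ * (g (y q t) - g (y p t))) := by field_simp
    simp only [hy', ← mul_sub]
    linarith
  have hk : 0 < κ * a * Real.cos δ := by positivity
  have h4 := mul_le_mul_of_nonneg_left hlow hk.le
  have h5 : 0 < κ * a * Real.cos δ * (m * D) := by positivity
  have h6 : (B - A + 1) * (Real.exp (-(r * t)) * -(r * 1))
      = -(κ * a * Real.cos δ * (m * D) / 2) := by rw [hD, hr]; ring
  rw [h6]
  nlinarith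

/-- After time `T` each oscillator of a lattice GK flow moves with the common frequency
`g (mean of ν)`, up to an exponentially small error that does not depend on the lattice. -/
theorem lattice_drift_le [Nonempty ι] {κ a δ A B m K : ℝ} {ν : ι → ℝ} {φ : ι → ι → ℝ}
    {g : ℝ → ℝ} {θ : ι → ℝ → ℝ} (hκ : 0 < κ) (ha : 0 < a) (hδ : 0 < δ)
    (hδ' : δ < Real.pi / 2) (hm : 0 < m) (hK : 0 < K) (hφ : ∀ i j, a ≤ φ i j)
    (hsymm : ∀ i j, φ i j = φ j i)
    (hmem : ∀ x i, latticeForce κ ν φ x i ∈ Icc A B)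
    (hg : ∀ s ∈ Icc A B, ∀ t ∈ Icc A B, s ≤ t → m * (t - s) ≤ g t - g s)
    (hlip : ∀ s t, |g s - g t| ≤ K * |s - t|)
    (hc : ∀ i, ContinuousOn (θ i) (Ici 0))
    (hd : ∀ i, ∀ t > 0, HasDerivAt (θ i) (g (latticeForce κ ν φ (fun j => θ j t) i)) t)
    (h0 : ∀ i j, θ i 0 - θ j 0 < δ) (hν : ∀ i j, ν i - ν j < κ * a * Real.sin δ)
    {T t : ℝ} (hT : 0 ≤ T) (hTt : T ≤ t) (i : ι) :
    |θ i t - θ i T - g ((∑ j, ν j) / Fintype.card ι) * (t - T)|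
      ≤ K * (B - A + 1) / (κ * a * Real.cos δ * m / 2)
        * Real.exp (-(κ * a * Real.cos δ * m / 2 * T)) := by
  have hn : (0 : ℝ) < Fintype.card ι := by exact_mod_cast Fintype.card_pos
  have hphase := lattice_phase_sub_lt hκ hδ hδ' hm hφ hmem hg hc hd h0 hν
  have hforce := lattice_force_sub_lt hκ ha hδ' hm hφ hmem hg hc hd hphase
  have hcos : 0 < Real.cos δ := Real.cos_pos_of_mem_Ioo ⟨by linarith, hδ'⟩
  set r := κ * a * Real.cos δ * m / 2 with hr
  have hrpos : 0 < r := by positivity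
  set ω := g ((∑ j, ν j) / Fintype.card ι) with hω
  have hAB : A ≤ B := (hmem 0 i).1.trans (hmem 0 i).2
  set E := K * (B - A + 1) / r with hE
  have hEpos : 0 < E := div_pos (mul_pos hK (by linarith)) hrpos
  -- By conservation `ω` is `g` of the mean force, and the distance of a force to the mean is at
  -- most the diameter of the forces. `E` is chosen so that the bound is minus the derivative of `E
  -- * exp (-(r * s))`.
  have hspeed : ∀ s > 0, |g (latticeForce κ ν φ (fun j => θ j s) i) - ω|
      ≤ E * (Real.exp (-(r * s)) * r) := by
    intro s hs
    refine (hlip _ _).trans ?_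
    have hE' : E * (Real.exp (-(r * s)) * r) = K * ((B - A + 1) * Real.exp (-(r * s))) := by
      rw [hE]; field_simp
    rw [hE']
    refine mul_le_mul_of_nonneg_left ?_ hK.le
    rw [← sum_latticeForce κ ν hsymm (fun j => θ j s)]
    set y := latticeForce κ ν φ (fun j => θ j s) with hy
    have h1 : y i - (∑ j, y j) / Fintype.card ι = (∑ j, (y i - y j)) / Fintype.card ι := by
      rw [Finset.sum_sub_distrib, Finset.sum_const, nsmul_eq_mul, Finset.card_univ]
      field_simp
    rw [h1, abs_div, abs_of_pos hn, div_le_iff₀ hn, mul_comm]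
    refine (Finset.abs_sum_le_sum_abs _ _).trans ?_
    rw [← nsmul_eq_mul, Fintype.card]
    refine Finset.sum_le_card_nsmul _ _ _ fun j _ => abs_le.2 ⟨?_, ?_⟩
    · linarith [hforce s hs.le j i]
    · exact (hforce s hs.le i j).le
  have hu : ∀ s > 0, HasDerivAt (fun s => θ i s - ω * s)
      (g (latticeForce κ ν φ (fun j => θ j s) i) - ω * 1) s := fun s hs =>
    (hd i s hs).sub ((hasDerivAt_id s).const_mul ω)
  have hv : ∀ s : ℝ, HasDerivAt (fun s => E * Real.exp (-(r * s)))
      (E * (Real.exp (-(r * s)) * -(r * 1))) s := fun s =>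
    (((hasDerivAt_id s).const_mul r).neg.exp).const_mul _
  have huc : ContinuousOn (fun s => θ i s - ω * s) (Ici 0) :=
    (hc i).sub (by fun_prop)
  have hvc : ContinuousOn (fun s => E * Real.exp (-(r * s))) (Ici 0) := by fun_prop
  have hint : ∀ s ∈ interior (Ici (0 : ℝ)), 0 < s := fun s hs => by simpa using hs
  -- Adding or subtracting `E * exp (-(r * s))` makes `θ i s - ω * s` monotone, which integrates the
  -- speed bound from `T` to `t`.
  have hanti : AntitoneOn (fun s => (θ i s - ω * s) + E * Real.exp (-(r * s))) (Ici 0) := by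
    refine antitoneOn_of_hasDerivWithinAt_nonpos (convex_Ici 0) (huc.add hvc)
      (fun s hs => ((hu s (hint s hs)).add (hv s)).hasDerivWithinAt) fun s hs => ?_
    have := abs_le.1 (hspeed s (hint s hs))
    linarith [this.2]
  have hmono : MonotoneOn (fun s => (θ i s - ω * s) - E * Real.exp (-(r * s))) (Ici 0) := by
    refine monotoneOn_of_hasDerivWithinAt_nonneg (convex_Ici 0) (huc.sub hvc)
      (fun s hs => ((hu s (hint s hs)).sub (hv s)).hasDerivWithinAt) fun s hs => ?_
    have := abs_le.1 (hspeed s (hint s hs))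
    linarith [this.1]
  have h1 := hanti hT (hT.trans hTt) hTt
  have h2 := hmono hT (hT.trans hTt) hTt
  have h3 : 0 < E * Real.exp (-(r * t)) := by positivity
  dsimp only at h1 h2
  rw [abs_le]
  constructor <;> linarith

end Lattice

/-! ### The continuum vector field on `L^∞` and on continuous functions. -/

section Field

set_option linter.unusedSectionVars false

open scoped BoundedContinuousFunction

variable {X : Type*} [MetricSpace X] [CompactSpace X] [MeasurableSpace X] [BorelSpace X]

/-- The right-hand side of the continuum GK model, solved for the frequency, with a truncated
inverse `g` of `F`. -/
def gkRate (μ : Measure X) (g : ℝ →ᵇ ℝ) (κ : ℝ) (ν : X → ℝ) (φ : X × X → ℝ) (u : X → ℝ)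
    (x : X) : ℝ :=
  g (ν x + κ / μ.real univ * ∫ z, φ (x, z) * Real.sin (u z - u x) ∂μ)

variable {μ : Measure X} [IsFiniteMeasure μ] {g : ℝ →ᵇ ℝ} {κ K b : ℝ} {ν : C(X, ℝ)}
  {φ : C(X × X, ℝ)}

/-- The integral sees only the a.e. class of `u`, but the sine also involves the value at `x`
itself; hence the two hypotheses. -/
theorem gkRate_congr_ae {u w : X → ℝ} (h : u =ᵐ[μ] w) {x : X} (hx : u x = w x) :
    gkRate μ g κ ν φ u x = gkRate μ g κ ν φ w x := by
  simp only [gkRate, hx]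
  congr 3
  exact integral_congr_ae (h.mono fun z hz => by simp only [hz])

theorem abs_mul_sin_le {a b s : ℝ} (h : |a| ≤ b) : |a * Real.sin s| ≤ b := by
  rw [abs_mul]
  nlinarith [Real.abs_sin_le_one s, abs_nonneg a]

theorem abs_interaction_le (hμ : 0 < μ.real univ) (hκ : 0 ≤ κ) (hφ : ∀ p, |φ p| ≤ b)
    (u : X → ℝ) (x : X) :
    |κ / μ.real univ * ∫ z, φ (x, z) * Real.sin (u z - u x) ∂μ| ≤ κ * b := by
  have h : ‖∫ z, φ (x, z) * Real.sin (u z - u x) ∂μ‖ ≤ b * μ.real univ :=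
    norm_integral_le_of_norm_le_const (ae_of_all _ fun z => abs_mul_sin_le (hφ _))
  rw [Real.norm_eq_abs] at h
  rw [abs_mul, abs_of_nonneg (by positivity), div_mul_eq_mul_div, div_le_iff₀ hμ, mul_assoc]
  exact mul_le_mul_of_nonneg_left h hκ

theorem integrable_kernel_mul_sin {u : X → ℝ} (hu : AEStronglyMeasurable u μ) (x : X) :
    Integrable (fun z => φ (x, z) * Real.sin (u z - u x)) μ := by
  refine Integrable.of_bound (C := ‖φ‖) ?_ (ae_of_all _ fun z =>
    abs_mul_sin_le (φ.norm_coe_le_norm (x, z)))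
  exact (φ.continuous.comp (by fun_prop : Continuous fun z => (x, z))).aestronglyMeasurable.mul
    (Real.continuous_sin.comp_aestronglyMeasurable (hu.sub aestronglyMeasurable_const))

/-- The sine is 1-Lipschitz and `u z - u x` changes by at most `2 * C`. Combining an a.e. bound with
a bound at `x` lets this serve both `L^∞` and `C(X)`. -/
theorem abs_gkRate_sub_le (hμ : 0 < μ.real univ) (hκ : 0 ≤ κ) (hK : 0 ≤ K)
    (hφ : ∀ p, |φ p| ≤ b) (hg : ∀ s t, |g s - g t| ≤ K * |s - t|) {u w : X → ℝ}
    (hu : AEStronglyMeasurable u μ) (hw : AEStronglyMeasurable w μ) {C : ℝ}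
    (h : ∀ᵐ z ∂μ, |u z - w z| ≤ C) {x : X} (hx : |u x - w x| ≤ C) :
    |gkRate μ g κ ν φ u x - gkRate μ g κ ν φ w x| ≤ K * (κ * (b * (2 * C))) := by
  refine (hg _ _).trans (mul_le_mul_of_nonneg_left ?_ hK)
  rw [add_sub_add_left_eq_sub, ← mul_sub,
    ← integral_sub (integrable_kernel_mul_sin hu x) (integrable_kernel_mul_sin hw x)]
  have hle : ‖∫ z, (φ (x, z) * Real.sin (u z - u x) - φ (x, z) * Real.sin (w z - w x)) ∂μ‖
      ≤ b * (2 * C) * μ.real univ := by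
    refine norm_integral_le_of_norm_le_const (h.mono fun z hz => ?_)
    rw [← mul_sub, norm_mul, Real.norm_eq_abs, Real.norm_eq_abs]
    have hb : 0 ≤ b := (abs_nonneg _).trans (hφ (x, z))
    refine mul_le_mul (hφ _) ?_ (abs_nonneg _) hb
    have h1 : |Real.sin (u z - u x) - Real.sin (w z - w x)| ≤ |u z - u x - (w z - w x)| := by
      rw [← Real.dist_eq, ← Real.dist_eq]
      simpa only [NNReal.coe_one, one_mul] using
        Real.lipschitzWith_sin.dist_le_mul (u z - u x) (w z - w x)
    refine h1.trans ?_
    have h2 : u z - u x - (w z - w x) = (u z - w z) - (u x - w x) := by ring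
    rw [h2]
    linarith [abs_sub (u z - w z) (u x - w x)]
  rw [Real.norm_eq_abs] at hle
  rw [abs_mul, abs_of_nonneg (by positivity), div_mul_eq_mul_div, div_le_iff₀ hμ, mul_assoc]
  exact mul_le_mul_of_nonneg_left hle hκ

theorem stronglyMeasurable_gkRate {u : X → ℝ} (hu : StronglyMeasurable u) :
    StronglyMeasurable (gkRate μ g κ ν φ u) := by
  have h : StronglyMeasurable fun p : X × X => φ p * Real.sin (u p.2 - u p.1) :=
    φ.continuous.stronglyMeasurable.mul (Real.continuous_sin.comp_stronglyMeasurable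
      ((hu.comp_measurable measurable_snd).sub (hu.comp_measurable measurable_fst)))
  exact g.continuous.comp_stronglyMeasurable
    (ν.continuous.stronglyMeasurable.add (h.integral_prod_right.const_mul _))

theorem abs_gkRate_le (u : X → ℝ) (x : X) : |gkRate μ g κ ν φ u x| ≤ ‖g‖ :=
  g.norm_coe_le_norm _

theorem memLp_gkRate {u : X → ℝ} (hu : StronglyMeasurable u) :
    MemLp (gkRate μ g κ ν φ u) ⊤ μ :=
  memLp_top_of_bound (stronglyMeasurable_gkRate hu).aestronglyMeasurable ‖g‖
    (ae_of_all _ fun x => abs_gkRate_le u x)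

variable (μ g κ ν φ)

/-- The continuum GK vector field on `L^∞`. -/
def gkFieldLp (U : Lp ℝ ⊤ μ) : Lp ℝ ⊤ μ :=
  (memLp_gkRate (g := g) (κ := κ) (ν := ν) (φ := φ) (Lp.stronglyMeasurable U)).toLp _

variable {μ g κ ν φ}

theorem coeFn_gkFieldLp (U : Lp ℝ ⊤ μ) : gkFieldLp μ g κ ν φ U =ᵐ[μ] gkRate μ g κ ν φ U :=
  MemLp.coeFn_toLp _

theorem Lp.ae_abs_sub_le_dist (U W : Lp ℝ ⊤ μ) : ∀ᵐ x ∂μ, |U x - W x| ≤ dist U W := by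
  have h1 := ae_le_eLpNormEssSup (f := (U - W : Lp ℝ ⊤ μ)) (μ := μ)
  filter_upwards [h1, Lp.coeFn_sub U W] with x hx hx'
  rw [← eLpNorm_exponent_top, ← Lp.enorm_def, hx', Pi.sub_apply, enorm_le_iff_norm_le] at hx
  rwa [dist_eq_norm]

theorem Lp.dist_le_of_ae_abs_sub_le {U W : Lp ℝ ⊤ μ} {C : ℝ} (hC : 0 ≤ C)
    (h : ∀ᵐ x ∂μ, |U x - W x| ≤ C) : dist U W ≤ C := by
  rw [dist_eq_norm]
  -- Since `ENNReal.toReal ⊤ = 0` and `0⁻¹ = 0`, the measure factor is a zeroth power, equal to 1.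
  have h1 : ‖U - W‖ ≤ μ.real univ ^ (ENNReal.toReal ⊤)⁻¹ * C := by
    refine Lp.norm_le_of_ae_bound hC ?_
    filter_upwards [h, Lp.coeFn_sub U W] with x hx hx'
    rwa [hx', Pi.sub_apply, Real.norm_eq_abs]
  simpa using h1

theorem lipschitzWith_gkFieldLp (hμ : 0 < μ.real univ) (hκ : 0 ≤ κ) (hK : 0 ≤ K) (hb : 0 ≤ b)
    (hφ : ∀ p, |φ p| ≤ b) (hg : ∀ s t, |g s - g t| ≤ K * |s - t|) :
    LipschitzWith (K * (κ * (b * 2))).toNNReal (gkFieldLp μ g κ ν φ) := by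
  refine LipschitzWith.of_dist_le_mul fun U W => ?_
  rw [Real.coe_toNNReal _ (by positivity)]
  refine Lp.dist_le_of_ae_abs_sub_le (by positivity) ?_
  have h := Lp.ae_abs_sub_le_dist U W
  filter_upwards [h, coeFn_gkFieldLp (g := g) (κ := κ) (ν := ν) (φ := φ) U,
    coeFn_gkFieldLp (g := g) (κ := κ) (ν := ν) (φ := φ) W] with x hx hU hW
  rw [hU, hW]
  refine (abs_gkRate_sub_le hμ hκ hK hφ hg (Lp.aestronglyMeasurable U)
    (Lp.aestronglyMeasurable W) h hx).trans (le_of_eq (by ring))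

theorem continuous_gkRate (u : C(X, ℝ)) : Continuous (gkRate μ g κ ν φ u) := by
  have h : Continuous fun x => ∫ z in univ, φ (x, z) * Real.sin (u z - u x) ∂μ :=
    continuous_parametric_integral_of_continuous
      (f := fun x z => φ (x, z) * Real.sin (u z - u x)) (by fun_prop) isCompact_univ
  rw [Measure.restrict_univ] at h
  exact g.continuous.comp (ν.continuous.add (continuous_const.mul h))

variable (μ g κ ν φ)

/-- The continuum GK vector field on the space of continuous functions. -/
def gkFieldC (u : C(X, ℝ)) : C(X, ℝ) :=
  ⟨gkRate μ g κ ν φ u, continuous_gkRate u⟩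

variable {μ g κ ν φ}

theorem norm_gkFieldC_le (u : C(X, ℝ)) : ‖gkFieldC μ g κ ν φ u‖ ≤ ‖g‖ :=
  (ContinuousMap.norm_le _ (norm_nonneg _)).2 fun x => abs_gkRate_le u x

theorem lipschitzWith_gkFieldC (hμ : 0 < μ.real univ) (hκ : 0 ≤ κ) (hK : 0 ≤ K) (hb : 0 ≤ b)
    (hφ : ∀ p, |φ p| ≤ b) (hg : ∀ s t, |g s - g t| ≤ K * |s - t|) :
    LipschitzWith (K * (κ * (b * 2))).toNNReal (gkFieldC μ g κ ν φ) := by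
  refine LipschitzWith.of_dist_le_mul fun u w => ?_
  rw [Real.coe_toNNReal _ (by positivity)]
  have h : ∀ x, |u x - w x| ≤ dist u w := fun x => by
    rw [← Real.dist_eq]
    exact ContinuousMap.dist_apply_le_dist x
  refine (ContinuousMap.dist_le (by positivity)).2 fun x => ?_
  refine (abs_gkRate_sub_le hμ hκ hK hφ hg u.continuous.aestronglyMeasurable
    w.continuous.aestronglyMeasurable (ae_of_all _ h) (h x)).trans (le_of_eq (by ring))

/-- The embedding of `C(X)` in `L^∞` intertwines the two fields, so it maps continuous solutions to
`L^∞` solutions. -/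
theorem toLp_gkFieldC (u : C(X, ℝ)) :
    ContinuousMap.toLp ⊤ μ ℝ (gkFieldC μ g κ ν φ u)
      = gkFieldLp μ g κ ν φ (ContinuousMap.toLp ⊤ μ ℝ u) := by
  apply Lp.ext
  have hu := ContinuousMap.coeFn_toLp (p := ⊤) (𝕜 := ℝ) μ u
  filter_upwards [ContinuousMap.coeFn_toLp (p := ⊤) (𝕜 := ℝ) μ (gkFieldC μ g κ ν φ u), hu,
    coeFn_gkFieldLp (g := g) (κ := κ) (ν := ν) (φ := φ) (ContinuousMap.toLp ⊤ μ ℝ u)]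
    with x h1 h2 h3
  rw [h1, h3]
  exact (gkRate_congr_ae hu h2).symm

/-- A right solution of an autonomous ODE with Lipschitz right-hand side is unique. -/
theorem eqOn_Ici_of_hasDerivWithinAt {E : Type*} [NormedAddCommGroup E] [NormedSpace ℝ E]
    {v : E → E} {C : NNReal} (hv : LipschitzWith C v) {f h : ℝ → E}
    (hf : ∀ t ≥ 0, HasDerivWithinAt f (v (f t)) (Ici 0) t)
    (hh : ∀ t ≥ 0, HasDerivWithinAt h (v (h t)) (Ici 0) t) (h0 : f 0 = h 0) :
    ∀ t ≥ 0, f t = h t := by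
  intro t ht
  refine ODE_solution_unique_of_mem_Icc_right (v := fun _ => v) (s := fun _ => univ) (K := C)
    (a := 0) (b := t) (fun _ _ => hv.lipschitzOnWith)
    (fun s hs => (hf s hs.1).continuousWithinAt.mono Icc_subset_Ici_self)
    (fun s hs => (hf s hs.1).mono (Ici_subset_Ici.2 hs.1)) (fun _ _ => trivial)
    (fun s hs => (hh s hs.1).continuousWithinAt.mono Icc_subset_Ici_self)
    (fun s hs => (hh s hs.1).mono (Ici_subset_Ici.2 hs.1)) (fun _ _ => trivial) h0
    (right_mem_Icc.2 ht)

end Field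

/-! ### Dyadic cells and cell averages. -/

section Cells

variable {d : ℕ} {D : Set (EuclideanSpace ℝ (Fin d))}

theorem lebesgueOn_univ [CompactSpace D] : lebesgueOn D univ = volume D := by
  have hD : MeasurableSet D := (isCompact_iff_compactSpace.2 ‹_›).measurableSet
  rw [lebesgueOn, comap_subtype_coe_apply hD, image_univ, Subtype.range_coe]

instance isFiniteMeasure_lebesgueOn [CompactSpace D] : IsFiniteMeasure (lebesgueOn D) :=
  ⟨by
    rw [lebesgueOn_univ]
    exact (isCompact_iff_compactSpace.2 ‹CompactSpace D›).measure_lt_top⟩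

theorem real_lebesgueOn_univ [CompactSpace D] : (lebesgueOn D).real univ = volume.real D := by
  rw [Measure.real, Measure.real, lebesgueOn_univ]

namespace IsDyadicPartition

variable {cell : ℕ → ℕ → Set D} (hcell : IsDyadicPartition cell)
include hcell

theorem subset_parent {N α : ℕ} (hα : α < 2 ^ (N + 1)) : cell (N + 1) α ⊆ cell N (α / 2) := by
  have h2 : α / 2 < 2 ^ N := by rw [pow_succ] at hα; omega
  rw [hcell.split N _ h2]
  rcases Nat.even_or_odd' α with ⟨k, rfl | rfl⟩
  · rw [show 2 * k / 2 = k by omega]; exact subset_union_left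
  · rw [show (2 * k + 1) / 2 = k by omega]; exact subset_union_right

theorem exists_mem (N : ℕ) (x : D) : ∃ α < 2 ^ N, x ∈ cell N α := by
  induction N with
  | zero => exact ⟨0, by simp, by rw [hcell.root]; trivial⟩
  | succ N ih =>
    obtain ⟨α, hα, hx⟩ := ih
    rw [hcell.split N α hα] at hx
    have hp : 2 ^ (N + 1) = 2 * 2 ^ N := by ring
    rcases hx with hx | hx
    · exact ⟨2 * α, by omega, hx⟩
    · exact ⟨2 * α + 1, by omega, hx⟩

theorem disjoint_of_ne {N α β : ℕ} (hα : α < 2 ^ N) (hβ : β < 2 ^ N) (h : α ≠ β) :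
    Disjoint (cell N α) (cell N β) := by
  induction N generalizing α β with
  | zero => simp at hα hβ; omega
  | succ N ih =>
    have hα2 : α / 2 < 2 ^ N := by rw [pow_succ] at hα; omega
    have hβ2 : β / 2 < 2 ^ N := by rw [pow_succ] at hβ; omega
    by_cases h2 : α / 2 = β / 2
    · have hd := hcell.disjoint N _ hα2
      rcases lt_or_gt_of_ne h with hlt | hlt
      · rwa [show 2 * (α / 2) + 1 = β by omega, show 2 * (α / 2) = α by omega] at hd
      · rw [show 2 * (α / 2) + 1 = α by omega, show 2 * (α / 2) = β by omega] at hd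
        exact hd.symm
    · exact (ih hα2 hβ2 h2).mono (hcell.subset_parent hα) (hcell.subset_parent hβ)

theorem real_cell [CompactSpace D] {N α : ℕ} (hα : α < 2 ^ N) :
    (lebesgueOn D).real (cell N α) = volume.real D / 2 ^ N := by
  induction N generalizing α with
  | zero =>
    have : α = 0 := by simpa using hα
    rw [this, hcell.root, real_lebesgueOn_univ, pow_zero, div_one]
  | succ N ih =>
    have h2 : α / 2 < 2 ^ N := by rw [pow_succ] at hα; omega
    have hp : 2 ^ (N + 1) = 2 * 2 ^ N := by ring
    have hsum : (lebesgueOn D).real (cell N (α / 2)) =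
        (lebesgueOn D).real (cell (N + 1) (2 * (α / 2)))
          + (lebesgueOn D).real (cell (N + 1) (2 * (α / 2) + 1)) := by
      rw [hcell.split N _ h2]
      exact measureReal_union₀ (hcell.nullMeasurableSet _ _ (by omega))
        (hcell.disjoint N _ h2).aedisjoint
    have heq : (lebesgueOn D).real (cell (N + 1) (2 * (α / 2))) =
        (lebesgueOn D).real (cell (N + 1) (2 * (α / 2) + 1)) := by
      rw [Measure.real, Measure.real, hcell.volume_eq N _ h2]
    rw [ih h2] at hsum
    have hgoal : (lebesgueOn D).real (cell (N + 1) α) =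
        (lebesgueOn D).real (cell (N + 1) (2 * (α / 2))) := by
      rcases Nat.even_or_odd' α with ⟨k, rfl | rfl⟩
      · rw [show 2 * k / 2 = k by omega]
      · rw [show (2 * k + 1) / 2 = k by omega] at heq ⊢
        exact heq.symm
    rw [hgoal, pow_succ, ← div_div]
    linarith

theorem nonempty_cell [CompactSpace D] (hD : 0 < volume.real D) {N α : ℕ} (hα : α < 2 ^ N) :
    (cell N α).Nonempty := by
  rw [nonempty_iff_ne_empty]
  intro h
  have := hcell.real_cell hα
  rw [h, measureReal_empty] at this
  have : 0 < volume.real D / 2 ^ N := by positivity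
  linarith

theorem integral_eq_sum [CompactSpace D] (N : ℕ) {f : D → ℝ} (hf : Integrable f (lebesgueOn D)) :
    ∫ x, f x ∂(lebesgueOn D) = ∑ i : Fin (2 ^ N), ∫ x in cell N i, f x ∂(lebesgueOn D) := by
  have hU : ⋃ i : Fin (2 ^ N), cell N i = univ := by
    refine eq_univ_of_forall fun x => ?_
    obtain ⟨α, hα, hx⟩ := hcell.exists_mem N x
    exact mem_iUnion.2 ⟨⟨α, hα⟩, hx⟩
  rw [← setIntegral_univ, ← hU, integral_iUnion_ae (s := fun i : Fin (2 ^ N) => cell N i)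
    (fun i => hcell.nullMeasurableSet N i i.2)
    (fun i j hij => (hcell.disjoint_of_ne i.2 j.2 (Fin.val_ne_of_ne hij)).aedisjoint)
    hf.integrableOn, tsum_fintype]

theorem cellAverage_mem_Icc [CompactSpace D] (hD : 0 < volume.real D) {f : D → ℝ}
    (hf : Integrable f (lebesgueOn D)) {N α : ℕ} (hα : α < 2 ^ N) {l u : ℝ}
    (h : ∀ x ∈ cell N α, f x ∈ Icc l u) : cellAverage cell f N α ∈ Icc l u := by
  have hmem : ∀ᵐ x ∂(lebesgueOn D).restrict (cell N α), x ∈ cell N α :=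
    ae_restrict_mem₀ (hcell.nullMeasurableSet N α hα)
  have hconst : ∀ c : ℝ, ∫ _ in cell N α, c ∂(lebesgueOn D) = volume.real D / 2 ^ N * c := by
    intro c
    rw [setIntegral_const, hcell.real_cell hα, smul_eq_mul]
  have h1 : volume.real D / 2 ^ N * l ≤ ∫ x in cell N α, f x ∂(lebesgueOn D) := by
    rw [← hconst]
    exact integral_mono_ae (integrable_const _) hf.integrableOn (hmem.mono fun x hx => (h x hx).1)
  have h2 : ∫ x in cell N α, f x ∂(lebesgueOn D) ≤ volume.real D / 2 ^ N * u := by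
    rw [← hconst]
    exact integral_mono_ae hf.integrableOn (integrable_const _) (hmem.mono fun x hx => (h x hx).2)
  have hc : (0 : ℝ) < 2 ^ N / volume.real D := by positivity
  have h3 := mul_le_mul_of_nonneg_left h1 hc.le
  have h4 := mul_le_mul_of_nonneg_left h2 hc.le
  have h5 : ∀ c : ℝ, 2 ^ N / volume.real D * (volume.real D / 2 ^ N * c) = c := by
    intro c; field_simp
  rw [h5] at h3 h4
  exact ⟨h3, h4⟩

theorem sum_cellAverage [CompactSpace D] (hD : 0 < volume.real D) {f : D → ℝ}
    (hf : Integrable f (lebesgueOn D)) (N : ℕ) :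
    (∑ i : Fin (2 ^ N), cellAverage cell f N i) / 2 ^ N
      = (∫ x, f x ∂(lebesgueOn D)) / volume.real D := by
  simp only [cellAverage]
  rw [← Finset.mul_sum, ← hcell.integral_eq_sum N hf]
  field_simp

/-- On the cells of fine partitions a continuous function is almost constant. -/
theorem eventually_abs_sub_le [CompactSpace D] {Y : Type*} [PseudoMetricSpace Y] [CompactSpace Y]
    (f : C(Y × D, ℝ)) {ε : ℝ} (hε : 0 < ε) :
    ∃ η > 0, ∀ᶠ N in atTop, ∀ α < 2 ^ N, ∀ x ∈ cell N α, ∀ x' ∈ cell N α, ∀ y y', dist y y' < η →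
      |f (y, x) - f (y', x')| ≤ ε := by
  obtain ⟨η, hη, h⟩ := Metric.uniformContinuous_iff.1
    (CompactSpace.uniformContinuous_of_continuous f.continuous) ε hε
  refine ⟨η, hη, ?_⟩
  filter_upwards [hcell.tendsto_diam.eventually (gt_mem_nhds hη)] with N hN α hα x hx x' hx' y y' hy
  have hbdd : BddAbove (range fun i : Fin (2 ^ N) => Metric.diam (cell N i)) :=
    (finite_range _).bddAbove
  -- `Metric.diam` is 0 on unbounded sets and a real supremum is 0 on unbounded families;
  -- compactness and finiteness exclude both.
  have h1 : dist x x' < η := ((Metric.dist_le_diam_of_mem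
    (Bornology.IsBounded.all _) hx hx').trans (le_ciSup hbdd ⟨α, hα⟩)).trans_lt hN
  have := h (a := (y, x)) (b := (y', x')) (by rw [Prod.dist_eq]; exact max_lt hy h1)
  rw [Real.dist_eq] at this
  exact this.le

theorem eventually_forall_abs_sub_le [CompactSpace D] (f : C(D, ℝ)) {ε : ℝ} (hε : 0 < ε) :
    ∀ᶠ N in atTop, ∀ α < 2 ^ N, ∀ x ∈ cell N α, ∀ x' ∈ cell N α, |f x - f x'| ≤ ε := by
  obtain ⟨η, hη, h⟩ := hcell.eventually_abs_sub_le (Y := Unit)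
    (f.comp (ContinuousMap.snd : C(Unit × D, D))) hε
  filter_upwards [h] with N hN α hα x hx x' hx'
  exact hN α hα x hx x' hx' () () (by simpa using hη)

theorem eventually_forall_abs_sub_le₂ [CompactSpace D] (f : C(D × D, ℝ)) {ε : ℝ} (hε : 0 < ε) :
    ∀ᶠ N in atTop, ∀ α < 2 ^ N, ∀ β < 2 ^ N, ∀ x ∈ cell N α, ∀ x' ∈ cell N α,
      ∀ y ∈ cell N β, ∀ y' ∈ cell N β, |f (x, y) - f (x', y')| ≤ ε := by
  obtain ⟨η, hη, h⟩ := hcell.eventually_abs_sub_le f hε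
  have h2 : ∀ᶠ N in atTop, ∀ α < 2 ^ N, ∀ x ∈ cell N α, ∀ x' ∈ cell N α, dist x x' < η := by
    filter_upwards [hcell.tendsto_diam.eventually (gt_mem_nhds hη)] with N hN α hα x hx x' hx'
    exact ((Metric.dist_le_diam_of_mem (Bornology.IsBounded.all _) hx hx').trans
      (le_ciSup (f := fun i : Fin (2 ^ N) => Metric.diam (cell N i)) (finite_range _).bddAbove
        ⟨α, hα⟩)).trans_lt hN
  filter_upwards [h, h2] with N hN hN2 α hα β hβ x hx x' hx' y hy y' hy'
  exact hN β hβ y hy y' hy' x x' (hN2 α hα x hx x' hx')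

theorem stepFunction_eq {N α : ℕ} (hα : α < 2 ^ N) {x : D} (hx : x ∈ cell N α)
    (Θ : ℕ → ℝ → ℝ) (t : ℝ) : stepFunction cell N Θ t x = Θ α t := by
  rw [stepFunction, Finset.sum_eq_single_of_mem α (Finset.mem_range.2 hα),
    indicator_of_mem hx]
  intro β hβ hne
  exact indicator_of_notMem
    (disjoint_left.1 (hcell.disjoint_of_ne hα (Finset.mem_range.1 hβ) hne.symm) hx) _

end IsDyadicPartition

theorem integrable_of_continuous [CompactSpace D] {f : D → ℝ} (hf : Continuous f) :
    Integrable f (lebesgueOn D) := by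
  obtain ⟨C, hC⟩ := isCompact_univ.exists_bound_of_continuousOn hf.continuousOn
  exact Integrable.of_bound hf.aestronglyMeasurable C (ae_of_all _ fun x => hC x trivial)

/-- Reduces bounds on double averages to two applications of
`IsDyadicPartition.cellAverage_mem_Icc`. -/
theorem cellAverage₂_eq (cell : ℕ → ℕ → Set D) (φ : D × D → ℝ) (N α β : ℕ) :
    cellAverage₂ cell φ N α β
      = cellAverage cell (fun x => cellAverage cell (fun y => φ (x, y)) N β) N α := by
  simp only [cellAverage, cellAverage₂, integral_const_mul]
  ring

theorem continuous_cellAverage [CompactSpace D] (cell : ℕ → ℕ → Set D) (φ : C(D × D, ℝ))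
    (N β : ℕ) : Continuous fun x => cellAverage cell (fun y => φ (x, y)) N β := by
  have h : Continuous fun x =>
      ∫ y in univ, φ (x, y) ∂((lebesgueOn D).restrict (cell N β)) :=
    continuous_parametric_integral_of_continuous (f := fun x y => φ (x, y)) φ.continuous
      isCompact_univ
  rw [Measure.restrict_univ] at h
  exact continuous_const.mul h

theorem IsDyadicPartition.cellAverage₂_mem_Icc [CompactSpace D] {cell : ℕ → ℕ → Set D}
    (hcell : IsDyadicPartition cell) (hD : 0 < volume.real D)
    (φ : C(D × D, ℝ)) {N α β : ℕ} (hα : α < 2 ^ N) (hβ : β < 2 ^ N) {l u : ℝ}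
    (h : ∀ x ∈ cell N α, ∀ y ∈ cell N β, φ (x, y) ∈ Icc l u) :
    cellAverage₂ cell φ N α β ∈ Icc l u := by
  rw [cellAverage₂_eq]
  refine hcell.cellAverage_mem_Icc hD
    (integrable_of_continuous (continuous_cellAverage cell φ N β)) hα fun x hx => ?_
  exact hcell.cellAverage_mem_Icc hD (integrable_of_continuous (by fun_prop)) hβ
    fun y hy => h x hx y hy

theorem cellAverage₂_comm [CompactSpace D] (cell : ℕ → ℕ → Set D) {φ : C(D × D, ℝ)}
    (hφ : ∀ x y : D, φ (x, y) = φ (y, x)) (N α β : ℕ) :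
    cellAverage₂ cell φ N α β = cellAverage₂ cell φ N β α := by
  simp only [cellAverage₂]
  rw [integral_integral_swap]
  · simp_rw [hφ]
  · refine Integrable.of_bound φ.continuous.aestronglyMeasurable ‖φ‖
      (ae_of_all _ fun p => φ.norm_coe_le_norm p)

end Cells

/-! ### Step functions in `L^∞`, consistency of the lattice field, and passage to the limit. -/

section Step

open scoped BoundedContinuousFunction

variable {d : ℕ} {D : Set (EuclideanSpace ℝ (Fin d))} [CompactSpace D] {cell : ℕ → ℕ → Set D}

/-- The class in `L^∞` of the step function with values `c` on the cells of the `N`-th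
partition. -/
def stepLp (hcell : IsDyadicPartition cell) (N : ℕ) (c : Fin (2 ^ N) → ℝ) :
    Lp ℝ ⊤ (lebesgueOn D) :=
  ∑ i, c i • (memLp_top_of_bound (f := (cell N i).indicator fun _ => (1 : ℝ))
    (aestronglyMeasurable_const.indicator₀ (hcell.nullMeasurableSet N i i.2)) 1
    (ae_of_all _ fun x => by by_cases hx : x ∈ cell N i <;> simp [hx])).toLp _

omit [CompactSpace D] in
theorem ae_stepLp_eq (hcell : IsDyadicPartition cell) (N : ℕ) (c : Fin (2 ^ N) → ℝ) :
    ∀ᵐ x ∂(lebesgueOn D), ∀ i : Fin (2 ^ N), x ∈ cell N i → stepLp hcell N c x = c i := by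
  rw [stepLp]
  set e : Fin (2 ^ N) → Lp ℝ ⊤ (lebesgueOn D) := fun i =>
    (memLp_top_of_bound (f := (cell N i).indicator fun _ => (1 : ℝ))
    (aestronglyMeasurable_const.indicator₀ (hcell.nullMeasurableSet N i i.2)) 1
    (ae_of_all _ fun x => by by_cases hx : x ∈ cell N i <;> simp [hx])).toLp _ with he
  have h1 : ∀ᵐ x ∂(lebesgueOn D), ∀ j, (c j • e j : Lp ℝ ⊤ (lebesgueOn D)) x = c j * e j x :=
    ae_all_iff.2 fun j => Lp.coeFn_smul (c j) (e j)
  have h2 : ∀ᵐ x ∂(lebesgueOn D), ∀ j : Fin (2 ^ N),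
      e j x = (cell N j).indicator (fun _ => (1 : ℝ)) x :=
    ae_all_iff.2 fun j => MemLp.coeFn_toLp _
  filter_upwards [Lp.coeFn_fun_finsetSum Finset.univ fun j => c j • e j, h1, h2]
    with x h0 h1 h2 i hi
  rw [h0, Finset.sum_eq_single_of_mem i (Finset.mem_univ i), h1, h2, indicator_of_mem hi, mul_one]
  intro j _ hj
  rw [h1, h2, indicator_of_notMem, mul_zero]
  exact disjoint_left.1 (hcell.disjoint_of_ne i.2 j.2 (Fin.val_ne_of_ne hj.symm)) hi

omit [CompactSpace D] in
-- The indicator classes do not depend on time, so differentiability in `L^∞` is that of finitely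
-- many scalar coefficients.
theorem hasDerivWithinAt_stepLp (hcell : IsDyadicPartition cell) {N : ℕ}
    {c : Fin (2 ^ N) → ℝ → ℝ} {c' : Fin (2 ^ N) → ℝ} {s : Set ℝ} {t : ℝ}
    (h : ∀ i, HasDerivWithinAt (c i) (c' i) s t) :
    HasDerivWithinAt (fun t => stepLp hcell N fun i => c i t) (stepLp hcell N c') s t :=
  HasDerivWithinAt.fun_sum fun i _ => (h i).smul_const _

theorem dist_stepLp_toLp_le (hcell : IsDyadicPartition cell) {N : ℕ} {c : Fin (2 ^ N) → ℝ}
    {U : Lp ℝ ⊤ (lebesgueOn D)} {v : D → ℝ} (hU : U =ᵐ[lebesgueOn D] v) {C : ℝ} (hC : 0 ≤ C)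
    (h : ∀ᵐ x ∂(lebesgueOn D), ∀ i : Fin (2 ^ N), x ∈ cell N i → |c i - v x| ≤ C) :
    dist (stepLp hcell N c) U ≤ C := by
  refine Lp.dist_le_of_ae_abs_sub_le hC ?_
  filter_upwards [ae_stepLp_eq hcell N c, hU, h] with x h1 h2 h3
  obtain ⟨α, hα, hx⟩ := hcell.exists_mem N x
  rw [h1 ⟨α, hα⟩ hx, h2]
  exact h3 ⟨α, hα⟩ hx

/-- The cell averages of the data on the `N`-th partition. -/
def gridForce (cell : ℕ → ℕ → Set D) (κ : ℝ) (ν : D → ℝ) (φ : D × D → ℝ) (N : ℕ) :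
    (Fin (2 ^ N) → ℝ) → Fin (2 ^ N) → ℝ :=
  latticeForce κ (fun i => cellAverage cell ν N i) fun i j => cellAverage₂ cell φ N i j

/-- The lattice GK vector field is close to the continuum GK vector field at step functions. -/
theorem dist_stepLp_gkFieldLp_le (hcell : IsDyadicPartition cell) (hD : 0 < volume.real D)
    {g : ℝ →ᵇ ℝ} {κ K ε : ℝ} {ν : C(D, ℝ)} {φ : C(D × D, ℝ)} (hκ : 0 ≤ κ) (hK : 0 ≤ K)
    (hε : 0 ≤ ε) (hg : ∀ s t, |g s - g t| ≤ K * |s - t|) {N : ℕ}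
    (hν : ∀ α < 2 ^ N, ∀ x ∈ cell N α, ∀ x' ∈ cell N α, |ν x - ν x'| ≤ ε)
    (hφ : ∀ α < 2 ^ N, ∀ β < 2 ^ N, ∀ x ∈ cell N α, ∀ x' ∈ cell N α,
      ∀ y ∈ cell N β, ∀ y' ∈ cell N β, |φ (x, y) - φ (x', y')| ≤ ε)
    (c : Fin (2 ^ N) → ℝ) :
    dist (stepLp hcell N fun i => g (gridForce cell κ ν φ N c i))
      (gkFieldLp (lebesgueOn D) g κ ν φ (stepLp hcell N c)) ≤ K * (1 + 2 * κ) * ε := by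
  refine dist_stepLp_toLp_le hcell (coeFn_gkFieldLp _) (by positivity) ?_
  filter_upwards [ae_stepLp_eq hcell N c] with x hx i hi
  have hint : Integrable
      (fun z => φ (x, z) * Real.sin (stepLp hcell N c z - stepLp hcell N c x)) (lebesgueOn D) :=
    integrable_kernel_mul_sin (Lp.aestronglyMeasurable _) x
  -- At a step function the sine is constant on each cell, so integration averages only `φ (x, ·)`.
  -- What remains is to compare `ν x` and these one-variable averages with the cell averages.
  have hcellint : ∀ j : Fin (2 ^ N), ∫ z in cell N j,
        φ (x, z) * Real.sin (stepLp hcell N c z - stepLp hcell N c x) ∂(lebesgueOn D)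
      = volume.real D / 2 ^ N *
        (cellAverage cell (fun y => φ (x, y)) N j * Real.sin (c j - c i)) := by
    intro j
    have h1 : ∫ z in cell N j,
          φ (x, z) * Real.sin (stepLp hcell N c z - stepLp hcell N c x) ∂(lebesgueOn D)
        = ∫ z in cell N j, φ (x, z) * Real.sin (c j - c i) ∂(lebesgueOn D) := by
      refine integral_congr_ae ?_
      filter_upwards [ae_restrict_mem₀ (hcell.nullMeasurableSet N j j.2),
        ae_restrict_of_ae (ae_stepLp_eq hcell N c)] with z hz hz'
      rw [hz' j hz, hx i hi]
    rw [h1, integral_mul_const, cellAverage]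
    field_simp
  rw [gkRate, hcell.integral_eq_sum N hint]
  simp only [hcellint]
  rw [← Finset.mul_sum, real_lebesgueOn_univ, mul_assoc K]
  refine (hg _ _).trans (mul_le_mul_of_nonneg_left ?_ hK)
  rw [gridForce, latticeForce, Fintype.card_fin]
  have hk : κ / volume.real D * (volume.real D / 2 ^ N *
      ∑ j : Fin (2 ^ N), cellAverage cell (fun y => φ (x, y)) N j * Real.sin (c j - c i))
      = κ / 2 ^ N *
        ∑ j : Fin (2 ^ N), cellAverage cell (fun y => φ (x, y)) N j * Real.sin (c j - c i) := by
    field_simp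
  rw [hk]
  push_cast
  rw [add_sub_add_comm, ← mul_sub, ← Finset.sum_sub_distrib]
  have hν' : |cellAverage cell ν N i - ν x| ≤ ε := by
    have := hcell.cellAverage_mem_Icc hD (integrable_of_continuous ν.continuous) i.2
      (l := ν x - ε) (u := ν x + ε) fun x' hx' => by
        have := abs_le.1 (hν i i.2 x' hx' x hi)
        constructor <;> linarith
    exact abs_le.2 ⟨by linarith [this.1], by linarith [this.2]⟩
  have hterm : ∀ j : Fin (2 ^ N), |cellAverage₂ cell φ N i j * Real.sin (c j - c i)
      - cellAverage cell (fun y => φ (x, y)) N j * Real.sin (c j - c i)| ≤ 2 * ε := by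
    intro j
    -- Both averages are within `ε` of `φ (x, y₀)`, whence `2 * ε`.
    obtain ⟨y₀, hy₀⟩ := hcell.nonempty_cell hD j.2
    have h1 := hcell.cellAverage₂_mem_Icc hD φ i.2 j.2 (l := φ (x, y₀) - ε) (u := φ (x, y₀) + ε)
      fun x' hx' y hy => by
        have := abs_le.1 (hφ i i.2 j j.2 x' hx' x hi y hy y₀ hy₀)
        constructor <;> linarith
    have h2 := hcell.cellAverage_mem_Icc hD (f := fun y => φ (x, y))
      (integrable_of_continuous (by fun_prop)) j.2 (l := φ (x, y₀) - ε) (u := φ (x, y₀) + ε)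
      fun y hy => by
        have := abs_le.1 (hφ i i.2 j j.2 x hi x hi y hy y₀ hy₀)
        constructor <;> linarith
    rw [← sub_mul]
    exact abs_mul_sin_le (abs_le.2 ⟨by linarith [h1.1, h2.2], by linarith [h1.2, h2.1]⟩)
  have hsum : |∑ j : Fin (2 ^ N), (cellAverage₂ cell φ N i j * Real.sin (c j - c i)
      - cellAverage cell (fun y => φ (x, y)) N j * Real.sin (c j - c i))| ≤ 2 ^ N * (2 * ε) := by
    refine (Finset.abs_sum_le_sum_abs _ _).trans
      ((Finset.sum_le_card_nsmul _ _ _ fun j _ => hterm j).trans (le_of_eq ?_))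
    simp
  refine (abs_add_le _ _).trans ?_
  rw [abs_mul, abs_of_nonneg (by positivity : 0 ≤ κ / 2 ^ N)]
  have h3 := mul_le_mul_of_nonneg_left hsum (by positivity : 0 ≤ κ / 2 ^ N)
  have h4 : κ / 2 ^ N * (2 ^ N * (2 * ε)) = 2 * κ * ε := by field_simp
  linarith

/-- Joint homogeneity in the initial error and the field error: a single small factor controls both.
-/
theorem gronwallBound_mul (c δ K ε x : ℝ) :
    gronwallBound (c * δ) K (c * ε) x = c * gronwallBound δ K ε x := by
  unfold gronwallBound
  split_ifs <;> ring

omit [CompactSpace D] in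
/-- A lattice solution solves the lattice system in solved form, up to the initial time. -/
theorem IsLatticeSolution.hasDerivWithinAt {L : EReal} {F g : ℝ → ℝ} {a b m K κ : ℝ}
    {ν : C(D, ℝ)} {φ : C(D × D, ℝ)} {θ₀ : C(D, ℝ)} {N : ℕ} {Θ : ℕ → ℝ → ℝ}
    (hΘ : IsLatticeSolution L F κ ν φ θ₀ cell N Θ) (hF : IsGKNonlinearity L F)
    (ha : a ∈ phaseInterval L) (hb : b ∈ phaseInterval L) (hg : IsTruncatedInverse F g a b m K)
    (hgc : Continuous g)
    (hmem : ∀ c i, gridForce cell κ ν φ N c i ∈ Icc (F a) (F b)) (i : Fin (2 ^ N)) :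
    (∀ t > 0, HasDerivAt (Θ i) (g (gridForce cell κ ν φ N (fun j => Θ j t) i)) t) ∧
    ∀ t ≥ 0, HasDerivWithinAt (Θ i) (g (gridForce cell κ ν φ N (fun j => Θ j t) i)) (Ici 0) t := by
  have hpos : ∀ t > 0, HasDerivAt (Θ i) (g (gridForce cell κ ν φ N (fun j => Θ j t) i)) t := by
    intro t ht
    obtain ⟨ω, hω, hd, heq⟩ := hΘ.equation i i.2 t ht
    have h : F ω = gridForce cell κ ν φ N (fun j => Θ j t) i := by
      rw [heq, gridForce, latticeForce, Fintype.card_fin, Finset.sum_range]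
      push_cast
      rfl
    rwa [← hg.eq_of_apply_eq hF ha hb hω (hmem _ _) h]
  refine ⟨hpos, fun t ht => ?_⟩
  rcases (show (0 : ℝ) ≤ t from ht).eq_or_lt with rfl | ht'
  -- The equation is given only for `t > 0`. The derivative has a limit at `0` from the right and `Θ
  -- i` is continuous there, which gives the one-sided derivative at `0`.
  · have hcont : ContinuousOn (fun t => g (gridForce cell κ ν φ N (fun j => Θ j t) i)) (Ici 0) := by
      refine hgc.comp_continuousOn (continuousOn_const.add (continuousOn_const.mul
        (continuousOn_finsetSum _ fun j _ => continuousOn_const.mul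
          (Real.continuous_sin.comp_continuousOn
            ((hΘ.continuousOn j j.2).sub (hΘ.continuousOn i i.2))))))
    refine hasDerivWithinAt_Ici_of_tendsto_deriv (s := Ioi 0)
      (fun s hs => (hpos s hs).differentiableAt.differentiableWithinAt)
      ((hΘ.continuousOn i i.2 0 (mem_Ici.2 le_rfl)).mono Ioi_subset_Ici_self) self_mem_nhdsWithin ?_
    refine Tendsto.congr' ?_ ((hcont 0 (mem_Ici.2 le_rfl)).mono_left
      (nhdsWithin_mono _ Ioi_subset_Ici_self))
    filter_upwards [self_mem_nhdsWithin] with s hs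
    exact (hpos s hs).deriv.symm
  · exact (hpos t ht').hasDerivWithinAt

/-- Convergence on bounded time intervals and a common asymptotic drift give convergence uniformly
on `[0, ∞)`. -/
theorem eventually_forall_dist_le_of_drift {E : Type*} [SeminormedAddCommGroup E] {S : ℕ → ℝ → E}
    {θ : ℝ → E} {r : ℝ → ℝ → E} {e : ℝ → ℝ} (he : Tendsto e atTop (𝓝 0))
    (hdrift : ∀ N ≥ 1, ∀ T ≥ 0, ∀ t ≥ T, dist (S N t) (S N T + r T t) ≤ e T)
    (hloc : ∀ T ≥ 0, ∀ ε > 0, ∀ᶠ N in atTop, ∀ t ∈ Icc 0 T, dist (S N t) (θ t) ≤ ε)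
    {ε : ℝ} (hε : 0 < ε) : ∀ᶠ N in atTop, ∀ t ≥ 0, dist (S N t) (θ t) ≤ ε := by
  have hlim : ∀ t ≥ 0, Tendsto (fun N => S N t) atTop (𝓝 (θ t)) := by
    intro t ht
    refine Metric.tendsto_nhds.2 fun η hη => ?_
    filter_upwards [hloc t ht (η / 2) (by positivity)] with N hN
    linarith [hN t (right_mem_Icc.2 ht)]
  -- The displacement `r T t` does not depend on `N`, so the drift bound passes to the limit.
  have hθ : ∀ T ≥ 0, ∀ t ≥ T, dist (θ t) (θ T + r T t) ≤ e T := by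
    intro T hT t ht
    refine le_of_tendsto ((hlim t (hT.trans ht)).dist ((hlim T hT).add_const (r T t))) ?_
    filter_upwards [eventually_ge_atTop 1] with N hN using hdrift N hN T hT t ht
  obtain ⟨T, hT, heT⟩ := ((eventually_ge_atTop (0 : ℝ)).and
    (he.eventually (gt_mem_nhds (by positivity : 0 < ε / 4)))).exists
  filter_upwards [hloc T hT (ε / 4) (by positivity), eventually_ge_atTop 1] with N hN hN1 t ht
  rcases le_total t T with h | h
  · linarith [hN t ⟨ht, h⟩]
  · have h1 := hdrift N hN1 T hT t h
    have h2 := hθ T hT t h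
    have h3 := hN T (right_mem_Icc.2 hT)
    have h4 : dist (S N T + r T t) (θ T + r T t) = dist (S N T) (θ T) := dist_add_right _ _ _
    -- The common displacement cancels, leaving two drift errors and the error at time `T`, each at
    -- most `ε / 4`.
    have h5 := dist_triangle4_right (S N t) (θ t) (S N T + r T t) (θ T + r T t)
    linarith

omit [CompactSpace D] in
theorem ae_stepLp_eq_stepFunction (hcell : IsDyadicPartition cell) (N : ℕ) (Θ : ℕ → ℝ → ℝ)
    (t : ℝ) : stepLp hcell N (fun i => Θ i t) =ᵐ[lebesgueOn D] stepFunction cell N Θ t := by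
  filter_upwards [ae_stepLp_eq hcell N fun i => Θ i t] with x hx
  obtain ⟨α, hα, hxα⟩ := hcell.exists_mem N x
  rw [hx ⟨α, hα⟩ hxα, hcell.stepFunction_eq hα hxα]

theorem convergesUniformlyEssSup_of_dist_le {u : ℕ → ℝ → D → ℝ}
    {S : ℕ → ℝ → Lp ℝ ⊤ (lebesgueOn D)} {θ : ℝ → Lp ℝ ⊤ (lebesgueOn D)}
    (hS : ∀ N, ∀ t, S N t =ᵐ[lebesgueOn D] u N t)
    (h : ∀ ε > 0, ∀ᶠ N in atTop, ∀ t ≥ 0, dist (S N t) (θ t) ≤ ε) :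
    ConvergesUniformlyEssSup u θ := by
  refine ENNReal.tendsto_nhds_zero.2 fun ε hε => ?_
  rcases eq_or_ne ε ⊤ with rfl | htop
  · exact Eventually.of_forall fun N => le_top
  filter_upwards [h ε.toReal (ENNReal.toReal_pos hε.ne' htop)] with N hN
  refine iSup₂_le fun t ht => essSup_le_of_ae_le _ ?_
  filter_upwards [hS N t, Lp.ae_abs_sub_le_dist (S N t) (θ t)] with x h1 h2
  rw [← h1]
  exact ENNReal.ofReal_le_of_le_toReal (h2.trans (hN t ht))

omit [CompactSpace D] in
-- For fixed `t`, countability of `N` gives one null set off which all the bounds hold; the triangle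
-- inequality is then used pointwise.
theorem ConvergesUniformlyEssSup.unique {u : ℕ → ℝ → D → ℝ} {θ θ' : ℝ → Lp ℝ ⊤ (lebesgueOn D)}
    (h : ConvergesUniformlyEssSup u θ) (h' : ConvergesUniformlyEssSup u θ') {t : ℝ} (ht : 0 ≤ t) :
    θ' t = θ t := by
  set A : (ℝ → Lp ℝ ⊤ (lebesgueOn D)) → ℕ → ENNReal := fun θ N =>
    ⨆ t ∈ Ici (0 : ℝ), essSup (fun x : D => ENNReal.ofReal |u N t x - θ t x|) (lebesgueOn D)
  have hle : ∀ θ : ℝ → Lp ℝ ⊤ (lebesgueOn D), ∀ᵐ x ∂(lebesgueOn D), ∀ N,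
      ENNReal.ofReal |u N t x - θ t x| ≤ A θ N := fun θ => ae_all_iff.2 fun N => by
    filter_upwards [ENNReal.ae_le_essSup fun x : D => ENNReal.ofReal |u N t x - θ t x|] with x hx
    exact hx.trans (le_iSup₂ (f := fun t (_ : t ∈ Ici (0 : ℝ)) =>
      essSup (fun x : D => ENNReal.ofReal |u N t x - θ t x|) (lebesgueOn D)) t ht)
  apply Lp.ext
  filter_upwards [hle θ, hle θ'] with x h1 h2
  have hlim : Tendsto (fun N => A θ N + A θ' N) atTop (𝓝 0) := by
    have hA : Tendsto (A θ) atTop (𝓝 0) := h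
    have hA' : Tendsto (A θ') atTop (𝓝 0) := h'
    simpa only [add_zero] using hA.add hA'
  have hzero : ENNReal.ofReal |θ' t x - θ t x| ≤ 0 := by
    refine ge_of_tendsto' hlim fun N => le_trans ?_ (add_le_add (h1 N) (h2 N))
    rw [← ENNReal.ofReal_add (abs_nonneg _) (abs_nonneg _)]
    refine ENNReal.ofReal_le_ofReal ?_
    have := abs_sub (u N t x - θ t x) (u N t x - θ' t x)
    rwa [sub_sub_sub_cancel_left] at this
  have h3 := ENNReal.ofReal_eq_zero.1 (le_antisymm hzero bot_le)
  exact sub_eq_zero.1 (abs_nonpos_iff.1 h3)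

end Step

/-! ### Convergence on bounded time intervals and the theorem. -/

section Main

open scoped BoundedContinuousFunction

theorem sub_le_rangeDiam {X : Type*} [TopologicalSpace X] [CompactSpace X] (f : C(X, ℝ)) (x y : X) :
    f x - f y ≤ rangeDiam f :=
  sub_le_sub (le_ciSup (isCompact_range f.continuous).bddAbove x)
    (ciInf_le (isCompact_range f.continuous).bddBelow y)

variable {d : ℕ} {D : Set (EuclideanSpace ℝ (Fin d))} [CompactSpace D] {cell : ℕ → ℕ → Set D}

theorem IsDyadicPartition.cellAverage_sub_le (hcell : IsDyadicPartition cell)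
    (hD : 0 < volume.real D) (f : C(D, ℝ)) {N α β : ℕ} (hα : α < 2 ^ N) (hβ : β < 2 ^ N) :
    cellAverage cell f N α - cellAverage cell f N β ≤ rangeDiam f := by
  have hmem : ∀ x, f x ∈ Icc (⨅ x, f x) (⨆ x, f x) := fun x =>
    ⟨ciInf_le (isCompact_range f.continuous).bddBelow x,
      le_ciSup (isCompact_range f.continuous).bddAbove x⟩
  exact sub_le_sub
    (hcell.cellAverage_mem_Icc hD (integrable_of_continuous f.continuous) hα fun x _ => hmem x).2
    (hcell.cellAverage_mem_Icc hD (integrable_of_continuous f.continuous) hβ fun x _ => hmem x).1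

/-- On bounded time intervals the lattice solutions converge to the continuum solution. -/
theorem eventually_dist_stepLp_le (hcell : IsDyadicPartition cell) (hD : 0 < volume.real D)
    {g : ℝ →ᵇ ℝ} {κ K b : ℝ} {ν : C(D, ℝ)} {φ : C(D × D, ℝ)} {θ₀ : C(D, ℝ)} (hκ : 0 ≤ κ)
    (hK : 0 ≤ K) (hb : 0 ≤ b) (hg : ∀ s t, |g s - g t| ≤ K * |s - t|) (hφ : ∀ p, |φ p| ≤ b)
    {Θ : ℕ → ℕ → ℝ → ℝ} (h0 : ∀ N ≥ 1, ∀ α < 2 ^ N, Θ N α 0 = cellAverage cell θ₀ N α)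
    (hd : ∀ N ≥ 1, ∀ i : Fin (2 ^ N), ∀ t ≥ 0, HasDerivWithinAt (Θ N i)
      (g (gridForce cell κ ν φ N (fun j => Θ N j t) i)) (Ici 0) t)
    {θ : ℝ → Lp ℝ ⊤ (lebesgueOn D)} (hθ0 : θ 0 = ContinuousMap.toLp ⊤ (lebesgueOn D) ℝ θ₀)
    (hθ : ∀ t ≥ 0, HasDerivWithinAt θ (gkFieldLp (lebesgueOn D) g κ ν φ (θ t)) (Ici 0) t)
    {T : ℝ} (hT : 0 ≤ T) {ε : ℝ} (hε : 0 < ε) :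
    ∀ᶠ N in atTop, ∀ t ∈ Icc 0 T, dist (stepLp hcell N fun i => Θ N i t) (θ t) ≤ ε := by
  have hμ : 0 < (lebesgueOn D).real univ := by rwa [real_lebesgueOn_univ]
  have hlip : LipschitzWith (K * (κ * (b * 2))).toNNReal (gkFieldLp (lebesgueOn D) g κ ν φ) :=
    lipschitzWith_gkFieldLp hμ hκ hK hb hφ hg
  set C := (K * (κ * (b * 2))).toNNReal
  have hmono := gronwallBound_mono (δ := 1) (ε := K * (1 + 2 * κ)) (K := C) zero_le_one
    (by positivity) C.coe_nonneg
  set G := gronwallBound 1 C (K * (1 + 2 * κ)) with hG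
  have hG1 : ∀ t ≥ 0, 1 ≤ G t := fun t ht => by
    have := hmono ht
    rwa [hG, gronwallBound_x0] at this
  have hGT : 0 < G T := zero_lt_one.trans_le (hG1 T hT)
  -- An oscillation of the data at most `ε / G T` on cells is amplified by at most `G T` up to time
  -- `T`.
  have hη : 0 < ε / G T := by positivity
  filter_upwards [eventually_ge_atTop 1, hcell.eventually_forall_abs_sub_le ν hη,
    hcell.eventually_forall_abs_sub_le θ₀ hη, hcell.eventually_forall_abs_sub_le₂ φ hη]
    with N hN hν hθ₀ hφN t ht
  have hinit : dist (stepLp hcell N fun i => Θ N i 0) (θ 0) ≤ ε / G T * 1 := by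
    rw [hθ0, mul_one]
    refine dist_stepLp_toLp_le hcell (ContinuousMap.coeFn_toLp (p := ⊤) (𝕜 := ℝ) _ θ₀) hη.le
      (ae_of_all _ fun x i hi => ?_)
    rw [h0 N hN i i.2]
    have := hcell.cellAverage_mem_Icc hD (integrable_of_continuous θ₀.continuous) i.2
      (l := θ₀ x - ε / G T) (u := θ₀ x + ε / G T) fun x' hx' => by
        have := abs_le.1 (hθ₀ i i.2 x' hx' x hi)
        constructor <;> linarith
    exact abs_le.2 ⟨by linarith [this.1], by linarith [this.2]⟩
  have hstep : ∀ s ≥ 0, HasDerivWithinAt (fun s => stepLp hcell N fun i => Θ N i s)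
      (stepLp hcell N fun i => g (gridForce cell κ ν φ N (fun j => Θ N j s) i)) (Ici 0) s :=
    fun s hs => hasDerivWithinAt_stepLp hcell fun i => hd N hN i s hs
  have hbound := dist_le_of_approx_trajectories_ODE (v := fun _ => gkFieldLp (lebesgueOn D) g κ ν φ)
    (K := C) (a := 0) (b := T) (δ := ε / G T * 1) (εf := K * (1 + 2 * κ) * (ε / G T)) (εg := 0)
    (fun _ => hlip) (fun s hs => (hstep s hs.1).continuousWithinAt.mono Icc_subset_Ici_self)
    (fun s hs => (hstep s hs.1).mono (Ici_subset_Ici.2 hs.1))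
    (fun s _ => dist_stepLp_gkFieldLp_le hcell hD hκ hK hη.le hg hν hφN _)
    (fun s hs => (hθ s hs.1).continuousWithinAt.mono Icc_subset_Ici_self)
    (fun s hs => (hθ s hs.1).mono (Ici_subset_Ici.2 hs.1))
    (fun s _ => (dist_self _).le) hinit t ht
  rw [add_zero, sub_zero, mul_comm (K * (1 + 2 * κ)), gronwallBound_mul] at hbound
  refine hbound.trans ?_
  calc ε / G T * G t ≤ ε / G T * G T := mul_le_mul_of_nonneg_left (hmono ht.2) hη.le
    _ = ε := by field_simp

end Main

end

theorem theorem4p1 {d : ℕ} (D : Set (EuclideanSpace ℝ (Fin d))) [CompactSpace D]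
    (hD : 0 < volume D)
    (L : EReal) (F : ℝ → ℝ) (hF : IsGKNonlinearity L F) (κ : ℝ)
    (ν : C(D, ℝ)) (φ : C(D × D, ℝ)) (θ₀ : C(D, ℝ))
    (hφ : ∀ x y : D, φ (x, y) = φ (y, x))
    (cell : ℕ → ℕ → Set D) (hcell : IsDyadicPartition cell)
    (hlarge : LargeCoupling L F κ ν φ θ₀)
    (Θ : ℕ → ℕ → ℝ → ℝ)
    (hΘ : ∀ N ≥ 1, IsLatticeSolution L F κ ν φ θ₀ cell N (Θ N)) :
    ∃ θ : ℝ → Lp ℝ ⊤ (lebesgueOn D),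
      ContDiffOn ℝ 1 θ (Ici 0) ∧
      ConvergesUniformlyEssSup (fun N => stepFunction cell N (Θ N)) θ ∧
      (∀ θ' : ℝ → Lp ℝ ⊤ (lebesgueOn D),
        ConvergesUniformlyEssSup (fun N => stepFunction cell N (Θ N)) θ' →
          ∀ t : ℝ, 0 ≤ t → θ' t = θ t) ∧
      ∃ ϑ : ℝ → C(D, ℝ),
        ContDiffOn ℝ 1 ϑ (Ici 0) ∧
        (∀ t : ℝ, 0 ≤ t → ∀ᵐ x ∂(lebesgueOn D), ϑ t x = θ t x) ∧
        IsClassicalSolution L F κ ν φ θ₀ (fun t x => ϑ t x) ∧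
        ∀ u : ℝ → D → ℝ, IsClassicalSolution L F κ ν φ θ₀ u →
          ∀ t : ℝ, 0 ≤ t → ∀ᵐ x ∂(lebesgueOn D), u t x = ϑ t x := by
  obtain ⟨a, b, aG, bG, θs, ha, hab, haG, hbG, hG, hθs, hθs', hθ₀, hφab, hκmax, hν⟩ := hlarge
  have hDfin : volume D < ⊤ := (isCompact_iff_compactSpace.2 ‹CompactSpace D›).measure_lt_top
  have hDpos : 0 < volume.real D := ENNReal.toReal_pos hD.ne' hDfin.ne
  have hμ : 0 < (lebesgueOn D).real univ := by rwa [real_lebesgueOn_univ]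
  obtain ⟨x₀⟩ : Nonempty D := by
    rw [nonempty_coe_sort]
    exact nonempty_of_measure_ne_zero hD.ne'
  have hsin : 0 < Real.sin θs := Real.sin_pos_of_pos_of_lt_pi hθs (by linarith)
  have hνdiam : 0 ≤ rangeDiam ν := by simpa using sub_le_rangeDiam ν x₀ x₀
  have hκ1 : rangeDiam ν / (a * Real.sin θs) < κ := (le_max_left _ _).trans_lt hκmax
  have hκ : 0 < κ := lt_of_le_of_lt (by positivity) hκ1
  -- The barrier needs a strict initial inequality but the data only give `rangeDiam θ₀ ≤ θs`. Any
  -- `δ` strictly between `θs` and `π / 2` works, as the sine increases there.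
  set δ := (θs + Real.pi / 2) / 2 with hδdef
  have hδ : 0 < δ := by linarith
  have hδ' : δ < Real.pi / 2 := by linarith
  have hνδ : rangeDiam ν < κ * a * Real.sin δ := by
    rw [div_lt_iff₀ (by positivity)] at hκ1
    have h1 : Real.sin θs < Real.sin δ :=
      Real.sin_lt_sin_of_lt_of_le_pi_div_two (by linarith) hδ'.le (by linarith)
    have h2 := mul_lt_mul_of_pos_left h1 (mul_pos hκ ha)
    linarith
  have hb : 0 < b := ha.trans_le hab
  have hφb : ∀ p, |φ p| ≤ b := fun p => by
    rw [abs_of_nonneg (ha.le.trans (hφab p.1 p.2).1)]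
    exact (hφab p.1 p.2).2
  obtain ⟨g₀, m, K, hm, hK, hg₀⟩ := hF.exists_isTruncatedInverse haG hbG hG
  have hg₀c : Continuous g₀ := by
    refine (LipschitzWith.of_dist_le_mul (K := K.toNNReal) fun s t => ?_).continuous
    rw [Real.coe_toNNReal _ hK.le]
    exact hg₀.abs_sub_le s t
  obtain ⟨g, hgg₀⟩ : ∃ g : BoundedContinuousFunction ℝ ℝ, (g : ℝ → ℝ) = g₀ :=
    ⟨BoundedContinuousFunction.ofNormedAddCommGroup g₀ hg₀c (max |aG| |bG|) fun s =>
      abs_le_max_abs_abs (hg₀.mem s).1 (hg₀.mem s).2, rfl⟩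
  rw [← hgg₀] at hg₀
  have hforce : ∀ u : D → ℝ, ∀ x : D, ν x + κ / (lebesgueOn D).real univ *
      ∫ z, φ (x, z) * Real.sin (u z - u x) ∂(lebesgueOn D) ∈ Icc (F aG) (F bG) := by
    intro u x
    have := abs_le.1 (abs_interaction_le (φ := φ) hμ hκ.le hφb u x)
    constructor <;> linarith [(hν x).1, (hν x).2]
  obtain ⟨ϑ, hϑ0, hϑ⟩ := exists_hasDerivAt_of_lipschitzWith (C := ‖g‖₊)
    (lipschitzWith_gkFieldC (ν := ν) hμ hκ.le hK.le hb.le hφb hg₀.abs_sub_le)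
    (fun u => norm_gkFieldC_le u) θ₀
  have hϑC1 : ContDiff ℝ 1 ϑ := by
    rw [contDiff_one_iff_deriv]
    refine ⟨fun t => (hϑ t).differentiableAt, ?_⟩
    rw [show deriv ϑ = fun t => gkFieldC (lebesgueOn D) g κ ν φ (ϑ t) from
      funext fun t => (hϑ t).deriv]
    exact (lipschitzWith_gkFieldC (ν := ν) hμ hκ.le hK.le hb.le hφb hg₀.abs_sub_le).continuous.comp
      (continuous_iff_continuousAt.2 fun t => (hϑ t).continuousAt)
  set ι := ContinuousMap.toLp (α := D) (E := ℝ) ⊤ (lebesgueOn D) ℝ with hι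
  set θ : ℝ → Lp ℝ ⊤ (lebesgueOn D) := fun t => ι (ϑ t) with hθdef
  have hθϑ : ∀ t, θ t =ᵐ[lebesgueOn D] ϑ t := fun t =>
    ContinuousMap.coeFn_toLp (p := ⊤) (𝕜 := ℝ) _ (ϑ t)
  have hθC1 : ContDiffOn ℝ 1 θ (Ici 0) := (ι.contDiff.comp hϑC1).contDiffOn
  have hθ : ∀ t ≥ 0, HasDerivWithinAt θ (gkFieldLp (lebesgueOn D) g κ ν φ (θ t)) (Ici 0) t := by
    intro t _
    rw [hθdef, ← toLp_gkFieldC]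
    exact (ι.hasFDerivAt.comp_hasDerivAt t (hϑ t)).hasDerivWithinAt
  have hθ0 : θ 0 = ι θ₀ := by rw [hθdef]; simp only [hϑ0]
  have hlipLp := lipschitzWith_gkFieldLp (ν := ν) hμ hκ.le hK.le hb.le hφb hg₀.abs_sub_le
  have hint : ∀ f : C(D, ℝ), Integrable f (lebesgueOn D) := fun f =>
    integrable_of_continuous f.continuous
  have hφN : ∀ N, ∀ i j : Fin (2 ^ N), cellAverage₂ cell φ N i j ∈ Icc a b := fun N i j =>
    hcell.cellAverage₂_mem_Icc hDpos φ i.2 j.2 fun x _ y _ => hφab x y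
  have hmem : ∀ N c i, gridForce cell κ ν φ N c i ∈ Icc (F aG) (F bG) := by
    intro N c i
    have hνN : ∀ i : Fin (2 ^ N), cellAverage cell ν N i ∈ Icc (F aG + κ * b) (F bG - κ * b) :=
      fun i => hcell.cellAverage_mem_Icc hDpos (hint ν) i.2 fun x _ => hν x
    refine latticeForce_mem_Icc hκ.le (fun i j => ?_) (fun i => (hνN i).1) (fun i => (hνN i).2) c i
    rw [abs_of_nonneg (ha.le.trans (hφN N i j).1)]
    exact (hφN N i j).2
  have hderiv := fun N hN => (hΘ N hN).hasDerivWithinAt hF haG hbG hg₀ g.continuous (hmem N)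
  set ω := g ((∫ x, ν x ∂(lebesgueOn D)) / volume.real D) with hω
  set r := κ * a * Real.cos δ * m / 2 with hr
  set E := K * (F bG - F aG + 1) / r with hE
  have hcos : 0 < Real.cos δ := Real.cos_pos_of_mem_Ioo ⟨by linarith, hδ'⟩
  have hrpos : 0 < r := by positivity
  have hFab : F aG < F bG := hF.strictMonoOn haG hbG hG
  have hEpos : 0 < E := div_pos (mul_pos hK (by linarith)) hrpos
  have hdrift : ∀ N ≥ 1, ∀ T ≥ 0, ∀ t ≥ T, dist (stepLp hcell N fun i => Θ N i t)
      ((stepLp hcell N fun i => Θ N i T) + ι (ContinuousMap.const D (ω * (t - T))))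
        ≤ E * Real.exp (-(r * T)) := by
    intro N hN T hT t ht
    -- Averages over cells of equal measure have the same mean as `ν`, so `ω` is the same for every
    -- `N`.
    have hmean : ω = g ((∑ i : Fin (2 ^ N), cellAverage cell ν N i) / Fintype.card (Fin (2 ^ N))) := by
      rw [Fintype.card_fin]
      push_cast
      rw [hcell.sum_cellAverage hDpos (hint ν)]
    refine dist_stepLp_toLp_le hcell
      (v := fun x => stepLp hcell N (fun i => Θ N i T) x + ω * (t - T)) ?_ (by positivity) ?_
    · filter_upwards [Lp.coeFn_add (stepLp hcell N fun i => Θ N i T)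
        (ι (ContinuousMap.const D (ω * (t - T)))),
        ContinuousMap.coeFn_toLp (p := ⊤) (𝕜 := ℝ) (lebesgueOn D)
          (ContinuousMap.const D (ω * (t - T)))] with x h1 h2
      rw [h1, Pi.add_apply, h2, ContinuousMap.const_apply]
    · filter_upwards [ae_stepLp_eq hcell N fun i => Θ N i T] with x hx i hi
      rw [hx i hi, ← sub_sub, hmean]
      refine lattice_drift_le (θ := fun i : Fin (2 ^ N) => Θ N i) hκ ha hδ hδ' hm hK
        (fun i j => (hφN N i j).1) (fun i j => cellAverage₂_comm cell hφ N i j) (hmem N)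
        hg₀.mul_sub_le hg₀.abs_sub_le (fun i => (hΘ N hN).continuousOn i i.2)
        (fun i => (hderiv N hN i).1) (fun i j => ?_) (fun i j => ?_) hT ht i
      · rw [(hΘ N hN).initial i i.2, (hΘ N hN).initial j j.2]
        linarith [hcell.cellAverage_sub_le hDpos θ₀ i.2 j.2]
      · exact (hcell.cellAverage_sub_le hDpos ν i.2 j.2).trans_lt hνδ
  have hetend : Tendsto (fun T => E * Real.exp (-(r * T))) atTop (𝓝 0) := by
    have := (Real.tendsto_exp_neg_atTop_nhds_zero.comp
      (tendsto_id.const_mul_atTop hrpos)).const_mul E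
    rwa [mul_zero] at this
  have hconv : ConvergesUniformlyEssSup (fun N => stepFunction cell N (Θ N)) θ := by
    refine convergesUniformlyEssSup_of_dist_le
      (fun N t => ae_stepLp_eq_stepFunction hcell N (Θ N) t) fun ε hε => ?_
    refine eventually_forall_dist_le_of_drift hetend hdrift (fun T hT η hη => ?_) hε
    exact eventually_dist_stepLp_le hcell hDpos hκ.le hK.le hb.le hg₀.abs_sub_le hφb
      (fun N hN α hα => (hΘ N hN).initial α hα) (fun N hN i => (hderiv N hN i).2) hθ0 hθ hT hη
  refine ⟨θ, hθC1, hconv, fun θ' hθ' t ht => hconv.unique hθ' ht, ϑ, hϑC1.contDiffOn,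
    fun t _ => (hθϑ t).symm, ⟨θ, hθC1, fun t _ => (hθϑ t).symm, fun t ht => ?_,
      ae_of_all _ fun x => by simp only [hϑ0]⟩, ?_⟩
  · rw [(hθ t ht).derivWithin (uniqueDiffOn_Ici 0 t ht)]
    filter_upwards [coeFn_gkFieldLp (g := g) (κ := κ) (ν := ν) (φ := φ) (θ t), hθϑ t] with x h1 h2
    rw [h1, gkRate_congr_ae (hθϑ t) h2, gkRate, hg₀.apply_eq _ (hforce _ x), real_lebesgueOn_univ]
    exact ⟨(ordConnected_phaseInterval L).out haG hbG (hg₀.mem _), rfl⟩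
  · rintro u ⟨U, hUC1, huU, hueq, hu0⟩ t ht
    have hU : ∀ t ≥ 0, HasDerivWithinAt U (gkFieldLp (lebesgueOn D) g κ ν φ (U t)) (Ici 0) t := by
      intro t ht
      have h1 := ((hUC1.differentiableOn (by norm_num)) t ht).hasDerivWithinAt
      -- The forcing lies in `[F aG, F bG]` for every phase profile, so injectivity of `F` forces
      -- any classical solution to follow the truncated field.
      have h2 : derivWithin U (Ici 0) t = gkFieldLp (lebesgueOn D) g κ ν φ (U t) := by
        apply Lp.ext
        filter_upwards [hueq t ht, huU t ht,
          coeFn_gkFieldLp (g := g) (κ := κ) (ν := ν) (φ := φ) (U t)] with x hx hx' hx''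
        rw [hx'', ← gkRate_congr_ae (huU t ht) hx']
        refine hg₀.eq_of_apply_eq hF haG hbG hx.1 (hforce _ x) ?_
        rw [hx.2, real_lebesgueOn_univ]
      rwa [h2] at h1
    have h0 : U 0 = θ 0 := by
      apply Lp.ext
      filter_upwards [huU 0 le_rfl, hu0, hθϑ 0] with x h1 h2 h3
      rw [← h1, h2, h3, hϑ0]
    have hUθ := eqOn_Ici_of_hasDerivWithinAt hlipLp hU hθ h0 t ht
    filter_upwards [huU t ht, hθϑ t] with x h1 h2
    rw [h1, hUθ, h2]
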